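/- **Setting.** Let $r\ge 1$, let $(X_1,d_1),\dots,(X_r,d_r)$ be locally compact Hadamard spaces (complete geodesic metric spaces in which all triangles satisfy the $\mathrm{CAT}(0)$ inequality), and let $X=X_1\times\cdots\times X_r$ with the metric $d=\sqrt{d_1^2+\cdots+d_r^2}$. For a Hadamard space $Y$, $\partial Y$ is the geometric boundary (classes of asymptotic geodesic rays), and $Y\cup\partial Y$ and $\partial Y$ carry the cone topology. The *Furstenberg boundary* of $X$ is $\partial^F X:=\partial X_1\times\cdots\times\partial X_r$ with the product topology; the group $\mathrm{Is}(X_1)\times\cdots\times\mathrm{Is}(X_r)$ acts on it componentwise. Every geodesic ray in $X$ is of the form $\sigma(t)=(\sigma_1(\theta_1t),\dots,\sigma_r(\theta_rt))$ with unit speed geodesics $\sigma_i$ in $X_i$, $\theta_i\ge 0$ and $\sum_i\theta_i^2=1$; it is *regular* if $\theta_i>0$ for all $i$. The regular boundary $\partial X^{reg}\subset\partial X$ is the set of classes of regular rays, and $\pi^F:\partial X^{reg}\to\partial^F X$ maps the class of a regular ray $\sigma$ to $(\sigma_1(\infty),\dots,\sigma_r(\infty))$. An isometry $h$ of a Hadamard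 space $Y$ is *rank one* if there are $l>0$ and a geodesic line $\sigma:\mathbb R\to Y$ with $h(\sigma(t))=\sigma(t+l)$ for all $t\in\mathbb R$ such that $\sigma$ does not bound a flat half-plane (there is no isometric embedding $\iota:[0,\infty)\times\mathbb R\to Y$ with closed convex image and $\iota(0,t)=\sigma(t)$ for all $t$). Two rank one isometries $g,h$ of $Y$ are *independent* if for every $y\in Y$ the map $\mathbb Z\times\mathbb Z\to[0,\infty)$, $(m,n)\mapsto d(g^m y,h^n y)$, is proper. An element $h=(h_1,\dots,h_r)\in\mathrm{Is}(X_1)\times\cdots\times\mathrm{Is}(X_r)$ is *regular axial* if every $h_i$ is a rank one isometry of $X_i$; two regular axial elements $g,h$ are *independent* if $g_i$ and $h_i$ are independent for every $i$. Let $\Gamma<\mathrm{Is}(X_1)\times\cdots\times\mathrm{Is}(X_r)$ be a subgroup which acts properly discontinuously on $X$ and contains two independent regular axial elements. Its geometric limit set is $L_\Gamma:=\overline{\Gamma\cdot x}\cap\partial X$, where $x\in X$ is arbitrary and the closure is taken in $X\cup\partial X$, and its *Furstenberg limit set* is $F_\Gamma:=\pi^F(L_\Gamma\cap\partial X^{reg})$.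 **Theorem 5.1.** The Furstenberg limit set $F_\Gamma$ is minimal, i.e. it is the smallest non-empty, closed, $\Gamma$-invariant subset of $\partial^F X$: it is itself non-empty, closed and $\Gamma$-invariant, and it is contained in every non-empty, closed, $\Gamma$-invariant subset of $\partial^F X$. -/

import Mathlib

open scoped NNReal

namespace HadamardProduct

/-! ### Hadamard spaces -/

section Hadamard

variable {X : Type*} [MetricSpace X]

/-- `σ` restricted to `[0, l]` is a geodesic path (parametrized by arc length) from `x` to `y`. -/
def IsGeodesicPath (σ : ℝ → X) (l : ℝ) (x y : X) : Prop :=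
  0 ≤ l ∧ σ 0 = x ∧ σ l = y ∧
    ∀ s ∈ Set.Icc (0 : ℝ) l, ∀ t ∈ Set.Icc (0 : ℝ) l, dist (σ s) (σ t) = |s - t|

/-- Any two points of `X` are joined by a geodesic path. -/
def IsGeodesicSpace (X : Type*) [MetricSpace X] : Prop :=
  ∀ x y : X, ∃ (σ : ℝ → X) (l : ℝ), IsGeodesicPath σ l x y

/-- The `CAT(0)` inequality: for a geodesic triangle with vertices `p, q, r`, a point `σ s` on the
side from `p` to `q` and a point `τ t` on the side from `p` to `r`, and for a Euclidean comparison
triangle `p', q', r'` with corresponding comparison points `x', y'` on its sides, the distance of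
the two points is at most the distance of the comparison points. (As the vertices are arbitrary,
this covers points on any two sides of a triangle.) -/
def SatisfiesCAT0 (X : Type*) [MetricSpace X] : Prop :=
  ∀ (p q r : X) (σ τ : ℝ → X) (a b : ℝ), IsGeodesicPath σ a p q → IsGeodesicPath τ b p r →
    ∀ p' q' r' : EuclideanSpace ℝ (Fin 2),
      dist p' q' = dist p q → dist p' r' = dist p r → dist q' r' = dist q r →
    ∀ s ∈ Set.Icc (0 : ℝ) a, ∀ t ∈ Set.Icc (0 : ℝ) b, ∀ x' y' : EuclideanSpace ℝ (Fin 2),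
      dist p' x' = s → dist x' q' = a - s → dist p' y' = t → dist y' r' = b - t →
      dist (σ s) (τ t) ≤ dist x' y'

/-- A Hadamard space: a complete geodesic metric space satisfying the `CAT(0)` inequality. -/
structure IsHadamardSpace (X : Type*) [MetricSpace X] : Prop where
  complete : CompleteSpace X
  geodesic : IsGeodesicSpace X
  cat0 : SatisfiesCAT0 X

/-! ### The geometric boundary and the cone topology -/

/-- Geodesic rays `σ : [0, ∞) → X`. -/
abbrev GeodesicRay (X : Type*) [MetricSpace X] : Type _ := {σ : ℝ≥0 → X // Isometry σ}

/-- Two rays are asymptotic if they stay at bounded distance. -/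
def Asymptotic (σ τ : GeodesicRay X) : Prop := ∃ C : ℝ, ∀ t : ℝ≥0, dist (σ.1 t) (τ.1 t) ≤ C

/-- Asymptoticity as an equivalence relation. -/
instance asymptoticSetoid (X : Type*) [MetricSpace X] : Setoid (GeodesicRay X) where
  r := Asymptotic
  iseqv :=
    { refl := fun _ => ⟨0, fun _ => by simp⟩
      symm := fun ⟨C, h⟩ => ⟨C, fun t => by rw [dist_comm]; exact h t⟩
      trans := fun ⟨C, h⟩ ⟨D, k⟩ =>
        ⟨C + D, fun t => (dist_triangle _ _ _).trans (add_le_add (h t) (k t))⟩ }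

/-- The geometric boundary: classes of asymptotic geodesic rays. -/
def Boundary (X : Type*) [MetricSpace X] : Type _ := Quotient (asymptoticSetoid X)

/-- The boundary point `σ(∞)` of a ray. -/
def GeodesicRay.endpoint (σ : GeodesicRay X) : Boundary X := Quotient.mk (asymptoticSetoid X) σ

/-- The disjoint union `X ∪ ∂X`. -/
inductive Bordification (X : Type*) [MetricSpace X] : Type _
  | point (x : X) : Bordification X
  | ideal (ξ : Boundary X) : Bordification X

/-- The standard cone neighbourhood `U(c, R, ε)` of `c(∞)` in `X ∪ ∂X`: all points `z` such that
the geodesic path or ray from `c(0)` to `z` has length `> R` and passes at distance `< ε` from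
`c(R)` at time `R`. -/
def coneNhd (c : GeodesicRay X) (R : ℝ≥0) (ε : ℝ) : Set (Bordification X) :=
  {z | (∃ (y : X) (σ : ℝ → X) (l : ℝ), z = .point y ∧ IsGeodesicPath σ l (c.1 0) y ∧
          (R : ℝ) < l ∧ dist (σ R) (c.1 R) < ε) ∨
       (∃ τ : GeodesicRay X, z = .ideal τ.endpoint ∧ τ.1 0 = c.1 0 ∧
          dist (τ.1 R) (c.1 R) < ε)}

/-- The cone topology on `X ∪ ∂X`. -/
instance (X : Type*) [MetricSpace X] : TopologicalSpace (Bordification X) :=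
  TopologicalSpace.generateFrom
    ({V | ∃ U : Set X, IsOpen U ∧ V = Bordification.point '' U} ∪
     {V | ∃ (c : GeodesicRay X) (R : ℝ≥0) (ε : ℝ), 0 < R ∧ 0 < ε ∧ V = coneNhd c R ε})

/-- The cone topology on `∂X`, as a subspace of `X ∪ ∂X`. -/
instance (X : Type*) [MetricSpace X] : TopologicalSpace (Boundary X) :=
  TopologicalSpace.induced Bordification.ideal inferInstance

/-! ### Isometries and their action -/

/-- The group of isometries acts on the space. -/
instance isometryMulAction (X : Type*) [MetricSpace X] : MulAction (X ≃ᵢ X) X where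
  smul g x := g x
  one_smul _ := rfl
  mul_smul _ _ _ := rfl

/-- The image of a ray under an isometry. -/
def GeodesicRay.map (g : X ≃ᵢ X) (σ : GeodesicRay X) : GeodesicRay X :=
  ⟨fun t => g (σ.1 t), g.isometry.comp σ.2⟩

/-- The group of isometries acts on the geometric boundary by `g · σ(∞) = (g ∘ σ)(∞)`. -/
instance boundaryMulAction (X : Type*) [MetricSpace X] : MulAction (X ≃ᵢ X) (Boundary X) where
  smul g := Quotient.map (GeodesicRay.map g) fun _ _ ⟨C, h⟩ =>
    ⟨C, fun t => (g.isometry.dist_eq _ _).le.trans (h t)⟩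
  one_smul ξ := Quotient.inductionOn ξ fun _ => rfl
  mul_smul _ _ ξ := Quotient.inductionOn ξ fun _ => rfl

/-- A set containing all geodesic paths between its points. -/
def GeodesicallyConvex (A : Set X) : Prop :=
  ∀ (σ : ℝ → X) (l : ℝ) (x y : X), x ∈ A → y ∈ A → IsGeodesicPath σ l x y →
    ∀ t ∈ Set.Icc (0 : ℝ) l, σ t ∈ A

/-- The line `σ` bounds a flat half-plane: there is an isometric embedding `ι` of the Euclidean
half-plane `[0, ∞) × ℝ` with closed convex image and `σ(t) = ι(0, t)`. -/
def BoundsFlatHalfPlane (σ : ℝ → X) : Prop :=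
  ∃ ι : WithLp 2 (ℝ≥0 × ℝ) → X, Isometry ι ∧ IsClosed (Set.range ι) ∧
    GeodesicallyConvex (Set.range ι) ∧ ∀ t : ℝ, σ t = ι (WithLp.toLp 2 (0, t))

/-- A rank one geodesic: a geodesic line which does not bound a flat half-plane. -/
def IsRankOneGeodesic (σ : ℝ → X) : Prop := Isometry σ ∧ ¬ BoundsFlatHalfPlane σ

/-- The geodesic line `σ` is an axis of `h`: `h` translates it by some `l > 0`. -/
def IsAxis (h : X ≃ᵢ X) (σ : ℝ → X) : Prop :=
  Isometry σ ∧ ∃ l : ℝ, 0 < l ∧ ∀ t : ℝ, h (σ t) = σ (t + l)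

/-- A rank one isometry: an (axial) isometry with a rank one axis. -/
def IsRankOneIsometry (h : X ≃ᵢ X) : Prop := ∃ σ : ℝ → X, IsAxis h σ ∧ IsRankOneGeodesic σ

/-- Independence of two (axial) isometries: for every `x` the map `(m, n) ↦ d(gᵐ x, hⁿ x)` from
`ℤ × ℤ` to `[0, ∞)` is proper. -/
def IndependentIsometries (g h : X ≃ᵢ X) : Prop :=
  ∀ x : X, IsProperMap fun p : ℤ × ℤ => nndist ((g ^ p.1) x) ((h ^ p.2) x)

/-- The geometric limit set: the boundary points in the closure, in `X ∪ ∂X`, of the orbit of the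
base point `x`. -/
def geometricLimitSet {G : Type*} [Group G] [MulAction G X] (Γ : Subgroup G) (x : X) :
    Set (Boundary X) :=
  {ξ | Bordification.ideal ξ ∈ closure (Bordification.point '' MulAction.orbit Γ x)}

end Hadamard

/-! ### Products -/

section Product

variable {r : ℕ} {X : Fin r → Type*} [∀ i, MetricSpace (X i)]

/-- The Furstenberg boundary `∂X₁ × ⋯ × ∂X_r`, with the product topology and with the componentwise
action of `Is(X₁) × ⋯ × Is(X_r)`. -/
abbrev FurstenbergBoundary (X : Fin r → Type*) [∀ i, MetricSpace (X i)] : Type _ :=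
  ∀ i, Boundary (X i)

/-- The set `E⁺` of unit vectors with positive coordinates. -/
def regularSlopes (r : ℕ) : Set (Fin r → ℝ≥0) := {θ | (∀ i, 0 < θ i) ∧ ∑ i, θ i ^ 2 = 1}

/-- The ray `σ` of the product (with the `ℓ²` metric) has slope `θ`, i.e. its `i`-th coordinate is a
geodesic of `X i` run through with constant speed `θ i`. -/
def HasSlope (σ : GeodesicRay (PiLp 2 X)) (θ : Fin r → ℝ≥0) : Prop :=
  ∀ (i : Fin r) (s t : ℝ≥0), dist (σ.1 s i) (σ.1 t i) = θ i * dist s t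

/-- The regular geometric boundary: the boundary points of rays with slope in `E⁺`. -/
def regularBoundary (X : Fin r → Type*) [∀ i, MetricSpace (X i)] : Set (Boundary (PiLp 2 X)) :=
  {ξ | ∃ (σ : GeodesicRay (PiLp 2 X)) (θ : Fin r → ℝ≥0),
    σ.endpoint = ξ ∧ θ ∈ regularSlopes r ∧ HasSlope σ θ}

/-- The `i`-th coordinate ray `σ_i` of a regular ray `σ(t) = (σ₁(θ₁ t), …, σ_r(θ_r t))`. -/
noncomputable def coordRay (σ : GeodesicRay (PiLp 2 X)) (θ : Fin r → ℝ≥0) (hθ : θ ∈ regularSlopes r)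
    (h : HasSlope σ θ) (i : Fin r) : GeodesicRay (X i) :=
  ⟨fun t => σ.1 (t / θ i) i, Isometry.of_dist_eq fun s t => by
    have h0 : (0 : ℝ) < θ i := hθ.1 i
    rw [h i, NNReal.dist_eq, NNReal.dist_eq, NNReal.coe_div, NNReal.coe_div, ← sub_div, abs_div,
      abs_of_pos h0, mul_div_cancel₀ _ h0.ne']⟩

/-- The Furstenberg projection `π^F`, sending the class of a regular ray to the tuple of classes of
its coordinate rays; `furstenbergProj_endpoint` shows that it does not depend on the ray. -/
noncomputable def furstenbergProj (ξ : regularBoundary X) : FurstenbergBoundary X := fun i =>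
  (coordRay ξ.2.choose ξ.2.choose_spec.choose ξ.2.choose_spec.choose_spec.2.1
    ξ.2.choose_spec.choose_spec.2.2 i).endpoint

/-- Asymptotic rays have the same slope. -/
lemma HasSlope.unique {σ τ : GeodesicRay (PiLp 2 X)} {θ θ' : Fin r → ℝ≥0} (h : HasSlope σ θ)
    (h' : HasSlope τ θ') (hst : Asymptotic σ τ) : θ = θ' := by
  obtain ⟨C, hC⟩ := hst
  have hC0 : 0 ≤ C := dist_nonneg.trans (hC 0)
  funext i
  have key : ∀ t : ℝ≥0, |(θ i : ℝ) - θ' i| * t ≤ 2 * C := by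
    intro t
    have e1 := h i 0 t
    have e2 := h' i 0 t
    have d0 := (PiLp.dist_apply_le (p := 2) (σ.1 0) (τ.1 0) i).trans (hC 0)
    have dt := (PiLp.dist_apply_le (p := 2) (σ.1 t) (τ.1 t) i).trans (hC t)
    have q := dist_dist_dist_le (σ.1 0 i) (σ.1 t i) (τ.1 0 i) (τ.1 t i)
    have e3 : dist (0 : ℝ≥0) t = t := by simp [NNReal.dist_eq]
    rw [e1, e2, e3, Real.dist_eq, ← sub_mul, abs_mul, abs_of_nonneg t.coe_nonneg] at q
    linarith
  by_contra hne
  have hpos : 0 < |(θ i : ℝ) - θ' i| :=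
    abs_pos.2 (sub_ne_zero.2 fun e => hne (NNReal.coe_injective e))
  have := key (Real.toNNReal ((2 * C + 1) / |(θ i : ℝ) - θ' i|))
  rw [Real.coe_toNNReal _ (by positivity), mul_div_cancel₀ _ hpos.ne'] at this
  linarith

/-- `π^F(σ(∞)) = (σ₁(∞), …, σ_r(∞))` for every regular ray `σ(t) = (σ₁(θ₁ t), …, σ_r(θ_r t))`. -/
lemma furstenbergProj_endpoint (σ : GeodesicRay (PiLp 2 X)) (θ : Fin r → ℝ≥0)
    (hθ : θ ∈ regularSlopes r) (h : HasSlope σ θ) (i : Fin r) :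
    furstenbergProj ⟨σ.endpoint, σ, θ, rfl, hθ, h⟩ i = (coordRay σ θ hθ h i).endpoint := by
  have hp : σ.endpoint ∈ regularBoundary X := ⟨σ, θ, rfl, hθ, h⟩
  change (coordRay hp.choose hp.choose_spec.choose hp.choose_spec.choose_spec.2.1
    hp.choose_spec.choose_spec.2.2 i).endpoint = _
  have ha : Asymptotic hp.choose σ := Quotient.exact hp.choose_spec.choose_spec.1
  have hs := HasSlope.unique hp.choose_spec.choose_spec.2.2 h ha
  obtain ⟨C, hC⟩ := ha
  refine Quotient.sound ⟨C, fun t => ?_⟩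
  simp only [coordRay, hs]
  exact (PiLp.dist_apply_le (p := 2) _ _ i).trans (hC _)

/-- The Furstenberg limit set `F_Γ = π^F(L_Γ ∩ ∂X^reg)` (with the limit set formed from the orbit of
`x`). -/
def furstenbergLimitSet (Γ : Subgroup (∀ i, X i ≃ᵢ X i)) (x : PiLp 2 X) :
    Set (FurstenbergBoundary X) :=
  furstenbergProj '' {ξ | (ξ : Boundary (PiLp 2 X)) ∈ geometricLimitSet Γ x}

/-- A regular axial isometry: all its projections to the factors are rank one isometries. -/
def IsRegularAxial (h : ∀ i, X i ≃ᵢ X i) : Prop := ∀ i, IsRankOneIsometry (h i)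

end Product

end HadamardProduct

open HadamardProduct

/-! The proof is a ping-pong argument carried out in all factors at once. Let `g`, `h` be the
independent regular axial elements, and let `h⁺`, `h⁻` be the tuples of positive and negative ends
of the axes of the `h i`. It suffices that the limit set is the closure of the orbit of `h⁺` and
lies in the closure of every orbit; minimality is then formal, invariance coming from
`smul_mem_closure`.

The closure of the orbit of `h⁺` lies in the limit set (`closure_orbit_subset`): for fixed `γ` the
points `γ h^k x` converge to a regular boundary point over `γ h⁺` whose slope is proportional to the
translation lengths of `h`. This slope does not depend on `γ`, so a limit of points `γ h⁺` lifts to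
the ray of the same slope, which is again approached by the orbit of `x`.

The limit set lies in the closure of the orbit of any `η` (`furstenbergLimitSet_subset_closure`): if
`γ_n x` converges to a regular point over `ξ`, then every coordinate converges to `ξ i`
(`tendsto_coord`), and along an ultrafilter the inverses converge to some `ζ i`. A rank one isometry
fixes only the ends of its axis, and by independence `g i` and `h i` share no end. So there are
powers of `g` moving all `ζ i` off `h⁺ i` and all `η i` off `h⁻ i`. For large `N` the segments from
`g^k γ_n⁻¹ x` to `h^N g^k' η` then pass at bounded distance from a base point in each factor, and so
`γ_n g^(-k) h^N g^k' η` tends to `ξ`.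

The geometric input concerns a single rank one axis: points whose projections run off to one end
converge to that end (`tendsto_geo_of_isProj_atBot`), and segments between points with projections
far apart on both sides pass near the axis (`exists_dist_seg_le`). If either fails, there are points
whose distance functions along the axis become affine of slope strictly between `-1` and `1`, and
these produce a flat half-plane (`boundsFlatHalfPlane_of_tendsto`). Beyond completeness and local
compactness, the only geometric hypothesis needed is the weighted Bruhat–Tits inequality, which
passes to `ℓ²` products by summation. -/

namespace HadamardProduct

open Filter Topology

/-! ### The Bruhat–Tits inequality -/

/-- Spaces in which any two points are joined by points satisfying the weighted Bruhat–Tits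
inequality. -/
class CNSpace (X : Type*) [MetricSpace X] : Prop where
  exists_seg : ∀ (x y : X) (s : ℝ), 0 ≤ s → s ≤ 1 → ∃ m : X, ∀ z : X,
    dist m z ^ 2 ≤ (1 - s) * dist x z ^ 2 + s * dist y z ^ 2 - s * (1 - s) * dist x y ^ 2

/-- With two vertices at the origin and `(a, 0)`, the law of cosines forces the abscissa of the
third; Heron's factorization shows that its ordinate is real. -/
lemma exists_comparison_triangle {a b c : ℝ} (ha : 0 < a)
    (h1 : a ≤ b + c) (h2 : b ≤ a + c) (h3 : c ≤ a + b) :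
    ∃ x y : ℝ, x ^ 2 + y ^ 2 = b ^ 2 ∧ (x - a) ^ 2 + y ^ 2 = c ^ 2 := by
  have hx : ((a ^ 2 + b ^ 2 - c ^ 2) / (2 * a)) ^ 2 ≤ b ^ 2 := by
    rw [div_pow, div_le_iff₀ (by positivity)]
    have e : b ^ 2 * (2 * a) ^ 2 - (a ^ 2 + b ^ 2 - c ^ 2) ^ 2 =
      ((a + b) + c) * ((a + b) - c) * ((c + (a - b)) * (c - (a - b))) := by ring
    have : 0 ≤ ((a + b) + c) * ((a + b) - c) * ((c + (a - b)) * (c - (a - b))) :=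
      mul_nonneg (mul_nonneg (by linarith) (by linarith)) (mul_nonneg (by linarith) (by linarith))
    linarith
  refine ⟨(a ^ 2 + b ^ 2 - c ^ 2) / (2 * a),
    √(b ^ 2 - ((a ^ 2 + b ^ 2 - c ^ 2) / (2 * a)) ^ 2), ?_, ?_⟩
  · rw [Real.sq_sqrt (by linarith)]; ring
  · rw [Real.sq_sqrt (by linarith)]; field_simp; ring

lemma dist_sq_fin_two (x y x' y' : ℝ) :
    dist (!₂[x, y] : EuclideanSpace ℝ (Fin 2)) !₂[x', y'] ^ 2 = (x - x') ^ 2 + (y - y') ^ 2 := by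
  rw [EuclideanSpace.dist_eq, Real.sq_sqrt (Finset.sum_nonneg fun _ _ => sq_nonneg _)]
  simp [Fin.sum_univ_two, Real.dist_eq, sq_abs]

lemma IsHadamardSpace.cnSpace {X : Type*} [MetricSpace X] (hX : IsHadamardSpace X) : CNSpace X where
  exists_seg x y s hs0 hs1 := by
    obtain ⟨σ, a, hσ⟩ := hX.geodesic x y
    obtain ⟨ha0, h0, ha, hd⟩ := id hσ
    have hxy : dist x y = a := by
      rw [← h0, ← ha, hd 0 ⟨le_rfl, ha0⟩ a ⟨ha0, le_rfl⟩, zero_sub, abs_neg, abs_of_nonneg ha0]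
    refine ⟨σ (s * a), fun z => ?_⟩
    rcases ha0.eq_or_lt with h | hpos
    · have : x = y := dist_eq_zero.1 (by rw [hxy, h])
      subst this
      rw [← h, mul_zero, h0, dist_self]
      linarith [sq_nonneg (dist x z)]
    obtain ⟨τ, b, hτ⟩ := hX.geodesic x z
    obtain ⟨hb0, k0, kb, kd⟩ := id hτ
    have hxz : dist x z = b := by
      rw [← k0, ← kb, kd 0 ⟨le_rfl, hb0⟩ b ⟨hb0, le_rfl⟩, zero_sub, abs_neg, abs_of_nonneg hb0]
    obtain ⟨u, v, e1, e2⟩ := exists_comparison_triangle (a := a) (b := b) (c := dist y z) hpos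
      (by rw [← hxy, ← hxz, dist_comm y z]; exact dist_triangle _ _ _)
      (by rw [← hxy, ← hxz]; exact dist_triangle _ _ _)
      (by rw [← hxy, ← hxz, dist_comm x y]; exact dist_triangle _ _ _)
    have hsq : ∀ {p q : EuclideanSpace ℝ (Fin 2)} {c : ℝ}, 0 ≤ c → dist p q ^ 2 = c ^ 2 →
        dist p q = c := fun hc h => (pow_left_inj₀ dist_nonneg hc two_ne_zero).1 h
    -- Only the case of a vertex and a point of the opposite side is needed, so the second point is
    -- the endpoint `z` of its side.
    have key := hX.cat0 x y z σ τ a b hσ hτ !₂[0, 0] !₂[a, 0] !₂[u, v]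
      (by rw [hxy]; exact hsq ha0 (by rw [dist_sq_fin_two]; ring))
      (by rw [hxz]; exact hsq hb0 (by rw [dist_sq_fin_two, ← e1]; ring))
      (hsq dist_nonneg (by rw [dist_sq_fin_two, ← e2]; ring))
      (s * a) ⟨by positivity, by nlinarith⟩ b ⟨hb0, le_rfl⟩ !₂[s * a, 0] !₂[u, v]
      (hsq (by positivity) (by rw [dist_sq_fin_two]; ring))
      (hsq (by nlinarith) (by rw [dist_sq_fin_two]; ring))
      (hsq hb0 (by rw [dist_sq_fin_two, ← e1]; ring))
      (by rw [dist_self, sub_self])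
    rw [kb] at key
    have := pow_le_pow_left₀ dist_nonneg key 2
    rw [dist_sq_fin_two] at this
    rw [hxz, hxy, ← e1, ← e2]
    refine this.trans (le_of_eq ?_)
    ring

lemma piLp_dist_sq {r : ℕ} {X : Fin r → Type*} [∀ i, MetricSpace (X i)] (x y : PiLp 2 X) :
    dist x y ^ 2 = ∑ i, dist (x i) (y i) ^ 2 := by
  rw [PiLp.dist_eq_sum (by norm_num)]
  have h : 0 ≤ ∑ i, dist (x i) (y i) ^ 2 := Finset.sum_nonneg fun _ _ => sq_nonneg _
  simp only [ENNReal.toReal_ofNat, Real.rpow_ofNat]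
  rw [← Real.sqrt_eq_rpow, Real.sq_sqrt h]

/-- Squared distances add up over the coordinates, and the same ratio `s` serves in every factor. -/
instance {r : ℕ} {X : Fin r → Type*} [∀ i, MetricSpace (X i)] [∀ i, CNSpace (X i)] :
    CNSpace (PiLp 2 X) where
  exists_seg x y s hs0 hs1 := by
    choose m hm using fun i => CNSpace.exists_seg (x i) (y i) s hs0 hs1
    refine ⟨WithLp.toLp 2 m, fun z => ?_⟩
    simp only [piLp_dist_sq, Finset.mul_sum, ← Finset.sum_add_distrib, ← Finset.sum_sub_distrib]
    exact Finset.sum_le_sum fun i _ => hm i (z i)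

lemma div_dist_le_one {X : Type*} [MetricSpace X] {x y : X} {t : ℝ} (h1 : t ≤ dist x y) : t / dist x y ≤ 1 :=
  div_le_one_of_le₀ h1 dist_nonneg

lemma div_dist_mul {X : Type*} [MetricSpace X] {x y : X} {t : ℝ} (h0 : 0 ≤ t) (h1 : t ≤ dist x y) :
    t / dist x y * dist x y = t := by
  rcases (dist_nonneg (x := x) (y := y)).eq_or_lt with h | h
  · rw [← h] at h1 ⊢; linarith
  · exact div_mul_cancel₀ _ h.ne'

lemma IsGeodesicPath.dist_eq {X : Type*} [MetricSpace X] {σ : ℝ → X} {l : ℝ} {x y : X} (h : IsGeodesicPath σ l x y) :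
    dist x y = l := by
  obtain ⟨h0, rfl, rfl, hd⟩ := h
  rw [hd 0 ⟨le_rfl, h0⟩ l ⟨h0, le_rfl⟩, zero_sub, abs_neg, abs_of_nonneg h0]

/-! ### Segments and convexity of the metric -/

section CN

variable {X : Type*} [MetricSpace X] [CNSpace X]

/-- The point dividing the segment from `x` to `y` at the ratio `s`. -/
noncomputable def seg (x y : X) (s : ℝ) : X :=
  open Classical in
  if h : 0 ≤ s ∧ s ≤ 1 then (CNSpace.exists_seg x y s h.1 h.2).choose else x

lemma dist_seg_sq_le (x y z : X) {s : ℝ} (h0 : 0 ≤ s) (h1 : s ≤ 1) :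
    dist (seg x y s) z ^ 2 ≤
      (1 - s) * dist x z ^ 2 + s * dist y z ^ 2 - s * (1 - s) * dist x y ^ 2 := by
  rw [seg, dif_pos ⟨h0, h1⟩]
  exact (CNSpace.exists_seg x y s h0 h1).choose_spec z

lemma dist_seg_left_le (x y : X) {s : ℝ} (h0 : 0 ≤ s) (h1 : s ≤ 1) :
    dist (seg x y s) x ≤ s * dist x y := by
  refine abs_le_of_sq_le_sq' ?_ (by positivity) |>.2
  have := dist_seg_sq_le x y x h0 h1
  rw [dist_self, dist_comm y x] at this
  linarith

lemma dist_seg_right_le (x y : X) {s : ℝ} (h0 : 0 ≤ s) (h1 : s ≤ 1) :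
    dist (seg x y s) y ≤ (1 - s) * dist x y := by
  refine abs_le_of_sq_le_sq' ?_ (mul_nonneg (by linarith) dist_nonneg) |>.2
  have := dist_seg_sq_le x y y h0 h1
  rw [dist_self] at this
  linarith

/-- The two upper bounds add up to `dist x y`, so the triangle inequality makes both of them
equalities. -/
lemma dist_left_seg (x y : X) {s : ℝ} (h0 : 0 ≤ s) (h1 : s ≤ 1) :
    dist x (seg x y s) = s * dist x y := by
  have a := dist_seg_left_le x y h0 h1
  have b := dist_seg_right_le x y h0 h1
  have c := dist_triangle x (seg x y s) y
  rw [dist_comm] at a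
  linarith

lemma dist_seg_right (x y : X) {s : ℝ} (h0 : 0 ≤ s) (h1 : s ≤ 1) :
    dist (seg x y s) y = (1 - s) * dist x y := by
  have a := dist_seg_left_le x y h0 h1
  have b := dist_seg_right_le x y h0 h1
  have c := dist_triangle x (seg x y s) y
  rw [dist_comm] at a
  linarith

/-- With `m` as test point, the right side of the Bruhat–Tits inequality is at most `(1 - s) s² + s
(1 - s)² - s (1 - s) = 0` times `dist x y ^ 2`. -/
lemma eq_seg {x y m : X} {s : ℝ} (h0 : 0 ≤ s) (h1 : s ≤ 1) (hx : dist x m ≤ s * dist x y)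
    (hy : dist y m ≤ (1 - s) * dist x y) : m = seg x y s := by
  have h := dist_seg_sq_le x y m h0 h1
  have a := pow_le_pow_left₀ dist_nonneg hx 2
  have b := pow_le_pow_left₀ dist_nonneg hy 2
  have : dist (seg x y s) m ^ 2 ≤ 0 := by
    have a' := mul_le_mul_of_nonneg_left a (sub_nonneg.2 h1)
    have b' := mul_le_mul_of_nonneg_left b h0
    nlinarith
  exact (dist_eq_zero.1 (pow_eq_zero_iff two_ne_zero |>.1 (le_antisymm this (sq_nonneg _)))).symm

@[simp] lemma seg_zero (x y : X) : seg x y 0 = x :=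
  (eq_seg le_rfl zero_le_one (by simp) (by simp [dist_comm])).symm

@[simp] lemma seg_one (x y : X) : seg x y 1 = y :=
  (eq_seg zero_le_one le_rfl (by simp) (by simp)).symm

lemma seg_symm (x y : X) {s : ℝ} (h0 : 0 ≤ s) (h1 : s ≤ 1) : seg x y s = seg y x (1 - s) := by
  refine eq_seg (by linarith) (by linarith) ?_ ?_
  · rw [dist_comm, dist_seg_right x y h0 h1, dist_comm]
  · rw [dist_left_seg x y h0 h1, dist_comm]; linarith

/-- Apply Bruhat–Tits to `seg x y s` and then to `seg x z s`: the terms in `dist x y` and `dist x z`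
cancel exactly. -/
lemma dist_seg_seg_left (x y z : X) {s : ℝ} (h0 : 0 ≤ s) (h1 : s ≤ 1) :
    dist (seg x y s) (seg x z s) ≤ s * dist y z := by
  refine abs_le_of_sq_le_sq' ?_ (by positivity) |>.2
  have e1 := dist_seg_sq_le x y (seg x z s) h0 h1
  have e2 := dist_seg_sq_le x z y h0 h1
  rw [dist_left_seg x z h0 h1] at e1
  rw [dist_comm, dist_comm z y] at e2
  nlinarith [mul_le_mul_of_nonneg_left e2 h0]

/-- Split the quadrilateral along the diagonal from `x` to `y'`; the second triangle has apex `y'`,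
hence the reversed parameter. -/
lemma dist_seg_seg (x y x' y' : X) {s : ℝ} (h0 : 0 ≤ s) (h1 : s ≤ 1) :
    dist (seg x y s) (seg x' y' s) ≤ (1 - s) * dist x x' + s * dist y y' := by
  have a := dist_seg_seg_left x y y' h0 h1
  have b := dist_seg_seg_left y' x x' (s := 1 - s) (by linarith) (by linarith)
  rw [← seg_symm _ _ h0 h1, ← seg_symm _ _ h0 h1] at b
  linarith [dist_triangle (seg x y s) (seg x y' s) (seg x' y' s)]

lemma dist_seg_left_seg_left (x y : X) {s t : ℝ} (hs0 : 0 ≤ s) (hst : s ≤ t) (ht : t ≤ 1) :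
    seg x y s = seg x (seg x y t) (s / t) := by
  rcases hs0.eq_or_lt with rfl | hs
  · simp
  have ht0 : 0 < t := hs.trans_le hst
  have hq0 : 0 ≤ s / t := by positivity
  have hq1 : s / t ≤ 1 := (div_le_one ht0).2 hst
  have e : s / t * t = s := div_mul_cancel₀ _ ht0.ne'
  have hx : dist x (seg x (seg x y t) (s / t)) = s * dist x y := by
    rw [dist_left_seg _ _ hq0 hq1, dist_left_seg _ _ ht0.le ht, ← mul_assoc, e]
  refine (eq_seg hs0 (hst.trans ht) hx.le ?_).symm
  have a := dist_seg_right x (seg x y t) hq0 hq1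
  have b := dist_seg_right x y ht0.le ht
  rw [dist_left_seg _ _ ht0.le ht, ← mul_assoc, sub_mul, e, one_mul] at a
  have c := dist_triangle (seg x (seg x y t) (s / t)) (seg x y t) y
  rw [dist_comm y]
  linarith

/-- Four point inequality for quadrilaterals. -/
lemma dist_sq_add_dist_sq_le (x y z w : X) : dist x z ^ 2 + dist y w ^ 2 ≤
    dist x y ^ 2 + dist y z ^ 2 + dist z w ^ 2 + dist w x ^ 2 := by
  have a := dist_seg_sq_le x z y (s := 1 / 2) (by norm_num) (by norm_num)
  have b := dist_seg_sq_le x z w (s := 1 / 2) (by norm_num) (by norm_num)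
  have c := dist_triangle_left y w (seg x z (1 / 2))
  have d := pow_le_pow_left₀ dist_nonneg c 2
  rw [dist_comm z y] at a
  rw [dist_comm x w] at b
  nlinarith [sq_nonneg (dist (seg x z (1 / 2)) y - dist (seg x z (1 / 2)) w)]

/-! ### Points at a given distance on a segment -/

/-- The point at distance `t` from `x` on the segment from `x` to `y`. -/
noncomputable def geo (x y : X) (t : ℝ) : X := seg x y (t / dist x y)

lemma dist_left_geo {x y : X} {t : ℝ} (h0 : 0 ≤ t) (h1 : t ≤ dist x y) :
    dist x (geo x y t) = t := by
  rw [geo, dist_left_seg x y (by positivity) (div_dist_le_one h1), div_dist_mul h0 h1]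

lemma dist_geo_right {x y : X} {t : ℝ} (h0 : 0 ≤ t) (h1 : t ≤ dist x y) :
    dist (geo x y t) y = dist x y - t := by
  rw [geo, dist_seg_right x y (by positivity) (div_dist_le_one h1), sub_mul, div_dist_mul h0 h1,
    one_mul]

lemma eq_geo {x y m : X} {t : ℝ} (h0 : 0 ≤ t) (h1 : t ≤ dist x y) (hx : dist x m ≤ t)
    (hy : dist y m ≤ dist x y - t) : m = geo x y t := by
  refine eq_seg (by positivity) (div_dist_le_one h1) ?_ ?_
  · rwa [div_dist_mul h0 h1]
  · rwa [sub_mul, div_dist_mul h0 h1, one_mul]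

@[simp] lemma geo_zero (x y : X) : geo x y 0 = x := by simp [geo]

lemma geo_dist (x y : X) : geo x y (dist x y) = y :=
  (eq_geo dist_nonneg le_rfl le_rfl (by simp)).symm

lemma geo_geo {x y : X} {s t : ℝ} (hs : 0 ≤ s) (hst : s ≤ t) (ht : t ≤ dist x y) :
    geo x (geo x y t) s = geo x y s := by
  have h := dist_left_geo (hs.trans hst) ht
  refine eq_geo hs (hst.trans ht) (dist_left_geo hs (by rwa [h])).le ?_
  have a := dist_geo_right (x := x) (y := geo x y t) hs (by rwa [h])
  have b := dist_geo_right (hs.trans hst) ht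
  have c := dist_triangle (geo x (geo x y t) s) (geo x y t) y
  rw [dist_comm]; linarith

lemma dist_geo_geo {x y : X} {s t : ℝ} (hs : 0 ≤ s) (hst : s ≤ t) (ht : t ≤ dist x y) :
    dist (geo x y s) (geo x y t) = t - s := by
  have h := dist_left_geo (hs.trans hst) ht
  have := dist_geo_right (x := x) (y := geo x y t) hs (by rwa [h])
  rwa [geo_geo hs hst ht, h] at this

/-- Geodesics from a common point diverge at least linearly. -/
lemma dist_geo_geo_le_div_mul {x y z : X} {t T : ℝ} (h0 : 0 ≤ t) (htT : t ≤ T) (hy : T ≤ dist x y)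
    (hz : T ≤ dist x z) :
    dist (geo x y t) (geo x z t) ≤ t / T * dist (geo x y T) (geo x z T) := by
  have ay := dist_left_geo (h0.trans htT) hy
  have az := dist_left_geo (h0.trans htT) hz
  rw [← geo_geo h0 htT hy, ← geo_geo h0 htT hz, geo.eq_1 x (geo x y T), geo.eq_1 x (geo x z T),
    ay, az]
  exact dist_seg_seg_left _ _ _ (div_nonneg h0 (h0.trans htT)) (div_le_one_of_le₀ htT (h0.trans htT))

/-- Cutting the longer segment back to the length of the shorter one moves its endpoint by at most
`dist y z`, whence the factor `2`; linear divergence gives the factor `t / T`. -/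
lemma dist_geo_geo_same_le {x y z : X} {t T : ℝ} (h0 : 0 ≤ t) (htT : t ≤ T) (hy : T ≤ dist x y)
    (hz : T ≤ dist x z) : dist (geo x y t) (geo x z t) ≤ t / T * (2 * dist y z) := by
  have hT : 0 ≤ T := h0.trans htT
  wlog h : dist x y ≤ dist x z generalizing y z
  · rw [dist_comm, dist_comm y z]
    exact this hz hy (le_of_not_ge h)
  refine (dist_geo_geo_le_div_mul h0 (htT.trans hy) le_rfl h).trans ?_
  rw [geo_dist]
  have a : dist y (geo x z (dist x y)) ≤ 2 * dist y z := by
    have := dist_triangle y z (geo x z (dist x y))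
    rw [dist_comm z, dist_geo_right dist_nonneg h] at this
    have := dist_triangle x y z
    linarith
  rcases hT.eq_or_lt with e | hT0
  · have : t = 0 := by linarith
    simp [this]
  · gcongr

/-- At equal ratio, convexity gives the bound `dist x x'`. Passing from equal ratio to equal arc
length costs at most `dist x x'` once more, because the two lengths differ by at most that much. -/
lemma dist_geo_base_le {x x' y : X} {t : ℝ} (h0 : 0 ≤ t) (h : t ≤ dist x y) (h' : t ≤ dist x' y) :
    dist (geo x y t) (geo x' y t) ≤ 2 * dist x x' := by
  set s := t / dist x y with hs
  have hs0 : 0 ≤ s := by positivity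
  have hs1 : s ≤ 1 := div_dist_le_one h
  have a : dist (geo x y t) (seg x' y s) ≤ dist x x' := by
    refine (dist_seg_seg x y x' y hs0 hs1).trans ?_
    rw [dist_self, mul_zero, add_zero]
    exact mul_le_of_le_one_left dist_nonneg (by linarith)
  have e : s * dist x y = t := div_dist_mul h0 h
  have b : dist (seg x' y s) (geo x' y t) ≤ dist x x' := by
    have hle : s * dist x' y ≤ dist x' y := mul_le_of_le_one_left dist_nonneg hs1
    have hq : seg x' y s = geo x' y (s * dist x' y) :=
      eq_geo (by positivity) hle (dist_left_seg _ _ hs0 hs1).le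
        (by rw [dist_comm, dist_seg_right _ _ hs0 hs1]; linarith)
    have hxx : |s * dist x' y - t| ≤ dist x x' := by
      rw [← e, ← mul_sub, abs_mul, abs_of_nonneg hs0]
      refine (mul_le_of_le_one_left (abs_nonneg _) hs1).trans ?_
      rw [dist_comm x x']
      exact abs_dist_sub_le _ _ _
    rw [hq]
    rcases le_total (s * dist x' y) t with hl | hl
    · rw [dist_geo_geo (by positivity) hl h']
      linarith [(abs_le.1 hxx).1]
    · rw [dist_comm, dist_geo_geo h0 hl hle]
      linarith [(abs_le.1 hxx).2]
  linarith [dist_triangle (geo x y t) (seg x' y s) (geo x' y t)]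

lemma IsGeodesicPath.eq_geo {σ : ℝ → X} {l : ℝ} {x y : X} (h : IsGeodesicPath σ l x y) {t : ℝ}
    (h0 : 0 ≤ t) (h1 : t ≤ l) : σ t = geo x y t := by
  have hl := h.dist_eq
  obtain ⟨hl0, rfl, rfl, hd⟩ := h
  refine HadamardProduct.eq_geo h0 (by rwa [hl]) ?_ ?_
  · rw [hd 0 ⟨le_rfl, hl0⟩ t ⟨h0, h1⟩, zero_sub, abs_neg, abs_of_nonneg h0]
  · rw [hl, hd l ⟨hl0, le_rfl⟩ t ⟨h0, h1⟩, abs_of_nonneg (by linarith)]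

lemma isGeodesicPath_geo (x y : X) : IsGeodesicPath (geo x y) (dist x y) x y := by
  refine ⟨dist_nonneg, geo_zero _ _, geo_dist _ _, fun s hs t ht => ?_⟩
  rcases le_total s t with h | h
  · rw [dist_geo_geo hs.1 h ht.2, abs_sub_comm, abs_of_nonneg (by linarith)]
  · rw [dist_comm, dist_geo_geo ht.1 h hs.2, abs_of_nonneg (by linarith)]

lemma map_seg (g : X ≃ᵢ X) (x y : X) {s : ℝ} (h0 : 0 ≤ s) (h1 : s ≤ 1) :
    g (seg x y s) = seg (g x) (g y) s := by
  refine eq_seg h0 h1 ?_ ?_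
  · rw [g.dist_eq, g.dist_eq, dist_left_seg _ _ h0 h1]
  · rw [g.dist_eq, g.dist_eq, dist_comm, dist_seg_right _ _ h0 h1]

lemma map_geo (g : X ≃ᵢ X) (x y : X) {t : ℝ} (h0 : 0 ≤ t) (h1 : t ≤ dist x y) :
    g (geo x y t) = geo (g x) (g y) t := by
  rw [geo, map_seg g x y (by positivity) (div_dist_le_one h1), geo, g.dist_eq]

/-! ### Properness -/

/-- Hopf–Rinow: let `ρ` be the supremum of the radii of compact balls about `o`. Geodesics show that
the ball of radius `ρ` is within `ε` of smaller compact balls, hence compact; by local compactness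
it has a neighbourhood of positive width in a compact set, so `ρ` is exceeded. -/
lemma properSpace_of_locallyCompact [CompleteSpace X] [LocallyCompactSpace X] : ProperSpace X := by
  refine ⟨fun o R => ?_⟩
  by_contra hR
  let S : Set ℝ := {r | IsCompact (Metric.closedBall o r)}
  have hmono : ∀ r ∈ S, ∀ r' ≤ r, r' ∈ S := fun r hr r' h =>
    IsCompact.of_isClosed_subset hr Metric.isClosed_closedBall (Metric.closedBall_subset_closedBall h)
  have hne : (0 : ℝ) ∈ S := by simp [S]
  have hub : ∀ r ∈ S, r ≤ R := fun r hr => le_of_not_gt fun h => hR (hmono r hr R h.le)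
  have hbdd : BddAbove S := ⟨R, hub⟩
  set ρ := sSup S with hρ
  have h0ρ : 0 ≤ ρ := le_csSup hbdd hne
  have hlt : ∀ r < ρ, r ∈ S := fun r hr => by
    obtain ⟨r', hr', h⟩ := exists_lt_of_lt_csSup ⟨0, hne⟩ hr
    exact hmono r' hr' r h.le
  have happ : ∀ r ≥ 0, ∀ y, ∃ y' ∈ Metric.closedBall o r, dist y y' ≤ max (dist o y - r) 0 := by
    intro r hr y
    rcases le_total (dist o y) r with h | h
    · exact ⟨y, by rwa [Metric.mem_closedBall, dist_comm], by simp⟩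
    · refine ⟨geo o y r, ?_, ?_⟩
      · rw [Metric.mem_closedBall, dist_comm, dist_left_geo hr h]
      · rw [dist_comm, dist_geo_right hr h]; exact le_max_left _ _
  have hρS : IsCompact (Metric.closedBall o ρ) := by
    refine isCompact_iff_totallyBounded_isComplete.2 ⟨?_, Metric.isClosed_closedBall.isComplete⟩
    rw [Metric.totallyBounded_iff]
    intro ε hε
    have hr : max (ρ - ε / 2) 0 ∈ S := by
      rcases max_choice (ρ - ε / 2) 0 with h | h <;> rw [h]
      · exact hlt _ (by linarith)
      · exact hne
    obtain ⟨t, ht, hcov⟩ := Metric.totallyBounded_iff.1 hr.totallyBounded (ε / 2) (by positivity)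
    refine ⟨t, ht, fun y hy => ?_⟩
    rw [Metric.mem_closedBall, dist_comm] at hy
    obtain ⟨y', hy', hd⟩ := happ (max (ρ - ε / 2) 0) (le_max_right _ _) y
    obtain ⟨z, hz, hyz⟩ := Set.mem_iUnion₂.1 (hcov hy')
    refine Set.mem_iUnion₂.2 ⟨z, hz, ?_⟩
    rw [Metric.mem_ball] at hyz ⊢
    have : max (dist o y - max (ρ - ε / 2) 0) 0 ≤ ε / 2 :=
      max_le (by linarith [le_max_left (ρ - ε / 2) 0]) (by positivity)
    linarith [dist_triangle y y' z]
  obtain ⟨K, hK, hsub⟩ := exists_compact_superset hρS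
  obtain ⟨δ, hδ, hth⟩ := hρS.exists_cthickening_subset_open isOpen_interior hsub
  have hmem : ρ + δ ∈ S := by
    refine hK.of_isClosed_subset Metric.isClosed_closedBall fun y hy => ?_
    rw [Metric.mem_closedBall, dist_comm] at hy
    obtain ⟨y', hy', hd⟩ := happ ρ h0ρ y
    exact interior_subset (hth (Metric.mem_cthickening_of_dist_le _ _ _ _ hy'
      (hd.trans (max_le (by linarith) hδ.le))))
  linarith [le_csSup hbdd hmem]

end CN

/-! ### Rays and limits of segments -/

section Rays

variable {X : Type*} [MetricSpace X]

lemma GeodesicRay.dist_eq (ρ : GeodesicRay X) (s t : ℝ≥0) :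
    dist (ρ.1 s) (ρ.1 t) = |(s : ℝ) - t| := by rw [ρ.2.dist_eq, NNReal.dist_eq]

lemma GeodesicRay.dist_zero (ρ : GeodesicRay X) (t : ℝ≥0) : dist (ρ.1 0) (ρ.1 t) = t := by
  rw [ρ.dist_eq, NNReal.coe_zero, zero_sub, abs_neg, NNReal.abs_eq]

lemma GeodesicRay.endpoint_eq_iff {ρ τ : GeodesicRay X} :
    ρ.endpoint = τ.endpoint ↔ Asymptotic ρ τ := Quotient.eq (r := asymptoticSetoid X)

lemma exists_ray_endpoint (ξ : Boundary X) : ∃ ρ : GeodesicRay X, ρ.endpoint = ξ :=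
  Quotient.exists_rep ξ

lemma map_endpoint (g : X ≃ᵢ X) (ρ : GeodesicRay X) : (ρ.map g).endpoint = g • ρ.endpoint := rfl

lemma Asymptotic.symm {σ τ : GeodesicRay X} (h : Asymptotic σ τ) : Asymptotic τ σ :=
  (asymptoticSetoid X).symm h

lemma exists_tendsto_of_bounded [ProperSpace X] {ι : Type*} (u : Ultrafilter ι) (y : ι → X) (o : X)
    (C : ℝ) (h : ∀ᶠ i in u, dist o (y i) ≤ C) : ∃ m, Tendsto y u (𝓝 m) := by
  obtain ⟨m, -, hm⟩ := (isCompact_closedBall o C).ultrafilter_le_nhds (u.map y) (by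
    refine tendsto_principal.2 ?_
    filter_upwards [h] with i hi
    rwa [Metric.mem_closedBall, dist_comm])
  exact ⟨m, hm⟩

variable [CNSpace X]

lemma geo_ray (ρ : GeodesicRay X) {t T : ℝ≥0} (h : t ≤ T) :
    geo (ρ.1 0) (ρ.1 T) t = ρ.1 t := by
  have h' : (t : ℝ) ≤ T := h
  refine (eq_geo t.coe_nonneg ?_ (ρ.dist_zero t).le ?_).symm
  · rwa [ρ.dist_zero]
  · rw [ρ.dist_zero, ρ.dist_eq, abs_of_nonneg (sub_nonneg.2 h')]

/-- The limit of segments of unbounded length is a ray. -/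
lemma exists_ray_of_tendsto [ProperSpace X] {ι : Type*} (u : Ultrafilter ι) (o : X) (y : ι → X)
    (h : Tendsto (fun i => dist o (y i)) u atTop) : ∃ ρ : GeodesicRay X, ρ.1 0 = o ∧
      ∀ t : ℝ≥0, Tendsto (fun i => geo o (y i) t) u (𝓝 (ρ.1 t)) := by
  have hex : ∀ t : ℝ≥0, ∃ m, Tendsto (fun i => geo o (y i) t) u (𝓝 m) := fun t =>
    exists_tendsto_of_bounded u _ o t (by
      filter_upwards [h.eventually_ge_atTop t] with i hi using (dist_left_geo t.coe_nonneg hi).le)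
  choose m hm using hex
  refine ⟨⟨m, Isometry.of_dist_eq fun s t => ?_⟩, ?_, hm⟩
  · refine tendsto_nhds_unique ((hm s).dist (hm t)) (tendsto_const_nhds.congr' ?_)
    filter_upwards [h.eventually_ge_atTop s, h.eventually_ge_atTop t] with i hs ht
    rw [(isGeodesicPath_geo o (y i)).2.2.2 s ⟨s.coe_nonneg, hs⟩ t ⟨t.coe_nonneg, ht⟩, NNReal.dist_eq]
  · refine tendsto_nhds_unique (hm 0) ?_
    simp

lemma dist_geo_ray_le (ρ : GeodesicRay X) {z : X} {t T : ℝ≥0} (htT : t ≤ T)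
    (hz : T ≤ dist (ρ.1 0) z) :
    dist (geo (ρ.1 0) z t) (ρ.1 t) ≤ t / T * dist (geo (ρ.1 0) z T) (ρ.1 T) := by
  have := dist_geo_geo_le_div_mul (x := ρ.1 0) (y := z) (z := ρ.1 T) t.coe_nonneg
    (T := T) htT hz (ρ.dist_zero T).ge
  rwa [geo_ray ρ htT, geo_ray ρ le_rfl] at this

lemma dist_ray_ray_le {ρ τ : GeodesicRay X} (h0 : ρ.1 0 = τ.1 0) {t T : ℝ≥0} (htT : t ≤ T) :
    dist (ρ.1 t) (τ.1 t) ≤ t / T * dist (ρ.1 T) (τ.1 T) := by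
  have := dist_geo_ray_le τ (z := ρ.1 T) htT (by rw [← h0, ρ.dist_zero])
  rwa [← h0, geo_ray ρ htT, geo_ray ρ le_rfl] at this

lemma eventually_div_mul_lt (t : ℝ≥0) (C : ℝ) {ε : ℝ} (hε : 0 < ε) :
    ∀ᶠ T : ℝ≥0 in atTop, (t : ℝ) / T * C < ε := by
  have h : Tendsto (fun T : ℝ≥0 => (t : ℝ) / T * C) atTop (𝓝 (0 * C)) :=
    (Tendsto.div_atTop tendsto_const_nhds (NNReal.tendsto_coe_atTop.2 tendsto_id)).mul_const C
  rw [zero_mul] at h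
  exact h.eventually_lt_const hε

/-- Points at bounded distance from far points of a ray converge to the endpoint of the ray. -/
lemma tendsto_geo_of_dist_ray_le {ι : Type*} {F : Filter ι} (ρ : GeodesicRay X) {z : ι → X}
    {T : ι → ℝ≥0} {C : ℝ} (hT : Tendsto T F atTop) (h : ∀ᶠ i in F, dist (z i) (ρ.1 (T i)) ≤ C)
    (t : ℝ≥0) : Tendsto (fun i => geo (ρ.1 0) (z i) t) F (𝓝 (ρ.1 t)) := by
  rw [Metric.tendsto_nhds]
  intro ε hε
  obtain ⟨S, hS, htS⟩ := ((eventually_div_mul_lt t (2 * C) hε).and (eventually_ge_atTop t)).exists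
  filter_upwards [h, hT.eventually_ge_atTop (S + C.toNNReal)] with i hi hTi
  have hTi' : (S : ℝ) + C ≤ T i := by
    have : ((S + C.toNNReal : ℝ≥0) : ℝ) ≤ T i := hTi
    push_cast at this
    linarith [Real.le_coe_toNNReal C]
  have hST : S ≤ T i := le_trans le_self_add hTi
  have h1 : S ≤ dist (ρ.1 0) (z i) := by
    have := dist_triangle (ρ.1 0) (z i) (ρ.1 (T i))
    rw [ρ.dist_zero] at this
    linarith
  have := dist_geo_geo_same_le t.coe_nonneg (T := S) htS h1
    (by rw [ρ.dist_zero]; exact hST : (S : ℝ) ≤ dist (ρ.1 0) (ρ.1 (T i)))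
  rw [geo_ray ρ (htS.trans hST)] at this
  refine (this.trans ?_).trans_lt hS
  gcongr

/-- Change of base point for convergence to a boundary point. -/
lemma tendsto_geo_of_asymptotic {ι : Type*} {F : Filter ι} {ρ τ : GeodesicRay X}
    (hτ : Asymptotic τ ρ) {z : ι → X} (hz : Tendsto (fun i => dist (ρ.1 0) (z i)) F atTop)
    (h : ∀ t : ℝ≥0, Tendsto (fun i => geo (ρ.1 0) (z i) t) F (𝓝 (ρ.1 t))) (t : ℝ≥0) :
    Tendsto (fun i => geo (τ.1 0) (z i) t) F (𝓝 (τ.1 t)) := by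
  obtain ⟨C, hC⟩ := hτ
  set D := dist (τ.1 0) (ρ.1 0)
  rw [Metric.tendsto_nhds]
  intro ε hε
  obtain ⟨T, hT, htT⟩ :=
    ((eventually_div_mul_lt t (2 * D + 1 + C) hε).and (eventually_ge_atTop t)).exists
  filter_upwards [Metric.tendsto_nhds.1 (h T) 1 one_pos, hz.eventually_ge_atTop (T + D)]
    with i hi hzi
  have hD : 0 ≤ D := dist_nonneg
  have h1 : (T : ℝ) ≤ dist (τ.1 0) (z i) := by
    have := dist_triangle_left (ρ.1 0) (z i) (τ.1 0)
    linarith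
  refine (dist_geo_ray_le τ htT h1).trans_lt (lt_of_le_of_lt ?_ hT)
  gcongr
  have h2 := dist_geo_base_le T.coe_nonneg h1 (by linarith : (T : ℝ) ≤ dist (ρ.1 0) (z i))
  have h3 := dist_triangle4 (geo (τ.1 0) (z i) T) (geo (ρ.1 0) (z i) T) (ρ.1 T) (τ.1 T)
  have h4 := hC T
  rw [dist_comm] at h4
  linarith

/-- The limits of segments issuing from two base points are asymptotic. -/
lemma asymptotic_of_tendsto {ι : Type*} {F : Filter ι} [F.NeBot] {ρ τ : GeodesicRay X} {z : ι → X}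
    (hz : Tendsto (fun i => dist (ρ.1 0) (z i)) F atTop)
    (h : ∀ t : ℝ≥0, Tendsto (fun i => geo (ρ.1 0) (z i) t) F (𝓝 (ρ.1 t)))
    (h' : ∀ t : ℝ≥0, Tendsto (fun i => geo (τ.1 0) (z i) t) F (𝓝 (τ.1 t))) (t : ℝ≥0) :
    dist (ρ.1 t) (τ.1 t) ≤ 2 * dist (ρ.1 0) (τ.1 0) := by
  refine le_of_tendsto ((h t).dist (h' t)) ?_
  filter_upwards [hz.eventually_ge_atTop (t + dist (ρ.1 0) (τ.1 0))] with i hi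
  refine dist_geo_base_le t.coe_nonneg ?_ ?_
  · exact le_trans (by simp) hi
  · have := dist_triangle (ρ.1 0) (τ.1 0) (z i)
    linarith

omit [CNSpace X] in
lemma GeodesicRay.tendsto_dist_atTop (ρ : GeodesicRay X) :
    Tendsto (fun T : ℝ≥0 => dist (ρ.1 0) (ρ.1 T)) atTop atTop := by
  simp only [ρ.dist_zero]
  exact NNReal.tendsto_coe_atTop.2 tendsto_id

lemma GeodesicRay.tendsto_geo (ρ : GeodesicRay X) (t : ℝ≥0) :
    Tendsto (fun T : ℝ≥0 => geo (ρ.1 0) (ρ.1 T) t) atTop (𝓝 (ρ.1 t)) :=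
  tendsto_geo_of_dist_ray_le ρ (C := 0) tendsto_id (by simp) t

omit [CNSpace X] in
lemma tendsto_dist_of_tendsto_dist {ι : Type*} {F : Filter ι} {o : X} (o' : X) {z : ι → X}
    (hz : Tendsto (fun i => dist o (z i)) F atTop) : Tendsto (fun i => dist o' (z i)) F atTop := by
  refine tendsto_atTop_mono (fun i => ?_) (tendsto_atTop_add_const_right F (-dist o o') hz)
  linarith [dist_triangle o o' (z i)]

/-- Every ray is asymptotic to a ray issuing from a given point. -/
lemma exists_asymptotic_ray [ProperSpace X] (ρ : GeodesicRay X) (o : X) : ∃ τ : GeodesicRay X,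
    τ.1 0 = o ∧ ∀ t : ℝ≥0, dist (ρ.1 t) (τ.1 t) ≤ 2 * dist (ρ.1 0) o := by
  have hz := ρ.tendsto_dist_atTop.mono_left (Ultrafilter.of_le (atTop : Filter ℝ≥0))
  obtain ⟨τ, rfl, hτ⟩ := exists_ray_of_tendsto (Ultrafilter.of atTop) o _
    (tendsto_dist_of_tendsto_dist o hz)
  exact ⟨τ, rfl, asymptotic_of_tendsto hz
    (fun t => (ρ.tendsto_geo t).mono_left (Ultrafilter.of_le _)) hτ⟩

/-! ### The cone topology -/

lemma point_mem_coneNhd {c : GeodesicRay X} {R : ℝ≥0} {ε : ℝ} {y : X} :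
    Bordification.point y ∈ coneNhd c R ε ↔
      (R : ℝ) < dist (c.1 0) y ∧ dist (geo (c.1 0) y R) (c.1 R) < ε := by
  constructor
  · rintro (⟨y', σ, l, hy, hσ, hl, hd⟩ | ⟨τ, h, -⟩)
    · obtain rfl : y = y' := by injection hy
      rw [hσ.dist_eq, ← hσ.eq_geo R.coe_nonneg hl.le]
      exact ⟨hl, hd⟩
    · cases h
  · rintro ⟨h, hd⟩
    exact Or.inl ⟨y, _, _, rfl, isGeodesicPath_geo _ _, h, hd⟩

omit [CNSpace X] in
lemma ideal_mem_coneNhd {c : GeodesicRay X} {R : ℝ≥0} {ε : ℝ} {ξ : Boundary X} :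
    Bordification.ideal ξ ∈ coneNhd c R ε ↔
      ∃ τ : GeodesicRay X, τ.endpoint = ξ ∧ τ.1 0 = c.1 0 ∧ dist (τ.1 R) (c.1 R) < ε := by
  constructor
  · rintro (⟨y', σ, l, hy, -⟩ | ⟨τ, h, h0, hd⟩)
    · cases hy
    · exact ⟨τ, by injection h with h; exact h.symm, h0, hd⟩
  · rintro ⟨τ, rfl, h0, hd⟩
    exact Or.inr ⟨τ, rfl, h0, hd⟩

omit [CNSpace X] in
lemma isOpen_coneNhd (c : GeodesicRay X) {R : ℝ≥0} {ε : ℝ} (hR : 0 < R) (hε : 0 < ε) :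
    IsOpen (coneNhd c R ε) :=
  TopologicalSpace.isOpen_generateFrom_of_mem (Or.inr ⟨c, R, ε, hR, hε, rfl⟩)

omit [CNSpace X] in
lemma endpoint_mem_coneNhd (c : GeodesicRay X) (R : ℝ≥0) {ε : ℝ} (hε : 0 < ε) :
    Bordification.ideal c.endpoint ∈ coneNhd c R ε :=
  ideal_mem_coneNhd.2 ⟨c, rfl, rfl, by simpa⟩

omit [CNSpace X] in
-- A subbasic cone neighbourhood containing `ξ` need not be centred on a ray ending at `ξ`; this is
-- why both the centre `c` and a ray `τ` from `c 0` to `ξ` occur.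
lemma tendsto_ideal_of_forall {ι : Type*} {F : Filter ι} {z : ι → Bordification X} {ξ : Boundary X}
    (h : ∀ (c τ : GeodesicRay X) (R : ℝ≥0) (ε : ℝ), τ.endpoint = ξ → τ.1 0 = c.1 0 →
      dist (τ.1 R) (c.1 R) < ε → ∀ᶠ i in F, z i ∈ coneNhd c R ε) :
    Tendsto z F (𝓝 (Bordification.ideal ξ)) := by
  refine TopologicalSpace.tendsto_nhds_generateFrom_iff.2 ?_
  rintro s (⟨U, -, rfl⟩ | ⟨c, R, ε, -, -, rfl⟩) hs
  · obtain ⟨_, _, h⟩ := hs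
    cases h
  · obtain ⟨τ, h1, h2, h3⟩ := ideal_mem_coneNhd.1 hs
    exact h c τ R ε h1 h2 h3

/-- Convergence of points to a boundary point can be tested from a single base point. -/
lemma tendsto_point {ι : Type*} {F : Filter ι} (ρ : GeodesicRay X) {z : ι → X}
    (hz : Tendsto (fun i => dist (ρ.1 0) (z i)) F atTop)
    (h : ∀ t : ℝ≥0, Tendsto (fun i => geo (ρ.1 0) (z i) t) F (𝓝 (ρ.1 t))) :
    Tendsto (fun i => Bordification.point (z i)) F (𝓝 (Bordification.ideal ρ.endpoint)) := by
  refine tendsto_ideal_of_forall fun c τ R ε hτ h0 hd => ?_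
  have key := tendsto_geo_of_asymptotic (GeodesicRay.endpoint_eq_iff.1 hτ) hz h R
  have hz' := tendsto_dist_of_tendsto_dist (c.1 0) hz
  filter_upwards [hz'.eventually_gt_atTop R, (key.dist tendsto_const_nhds).eventually_lt_const hd]
    with i h1 h2
  rw [h0] at h2
  exact point_mem_coneNhd.2 ⟨h1, h2⟩

/-- Convergence of boundary points can be tested from a single base point. -/
lemma tendsto_endpoint [ProperSpace X] {ι : Type*} {F : Filter ι} (ρ : GeodesicRay X)
    {ζ : ι → GeodesicRay X} (h0 : ∀ i, (ζ i).1 0 = ρ.1 0)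
    (h : ∀ t : ℝ≥0, Tendsto (fun i => (ζ i).1 t) F (𝓝 (ρ.1 t))) :
    Tendsto (fun i => (ζ i).endpoint) F (𝓝 ρ.endpoint) := by
  rw [nhds_induced, tendsto_comap_iff]
  refine tendsto_ideal_of_forall fun c τ R ε hτ hc hd => ?_
  obtain ⟨C, hC⟩ := GeodesicRay.endpoint_eq_iff.1 hτ
  set D := dist (ρ.1 0) (c.1 0)
  -- `c` may start elsewhere than `ρ`. Passing to rays from `c 0` leaves an error of at most `2 * D
  -- + 1 + C` at time `T`, which shrinks by the factor `R / T` at time `R`.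
  obtain ⟨T, hT, htT⟩ := ((eventually_div_mul_lt R (2 * D + 1 + C) (sub_pos.2 hd)).and
    (eventually_ge_atTop R)).exists
  filter_upwards [Metric.tendsto_nhds.1 (h T) 1 one_pos] with i hi
  obtain ⟨υ, hυ0, hυ⟩ := exists_asymptotic_ray (ζ i) (c.1 0)
  refine ideal_mem_coneNhd.2 ⟨υ, GeodesicRay.endpoint_eq_iff.2 (Asymptotic.symm ⟨_, hυ⟩), hυ0, ?_⟩
  have h1 := dist_ray_ray_le (hυ0.trans hc.symm) htT
  have h2 : dist (υ.1 T) (τ.1 T) ≤ 2 * D + 1 + C := by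
    have a := dist_triangle4 (υ.1 T) ((ζ i).1 T) (ρ.1 T) (τ.1 T)
    have b := hυ T
    rw [h0 i, dist_comm] at b
    have e := hC T
    rw [dist_comm] at e
    linarith
  have h3 : (R : ℝ) / T * dist (υ.1 T) (τ.1 T) ≤ R / T * (2 * D + 1 + C) := by gcongr
  linarith [dist_triangle (υ.1 R) (τ.1 R) (c.1 R)]

end Rays

/-! ### Closures in the Furstenberg boundary -/

section Furstenberg

variable {r : ℕ} {X : Fin r → Type*} [∀ i, MetricSpace (X i)]

/-- A point of the closure is approximated by rays from the base points of representing rays. -/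
lemma exists_rays_of_mem_closure {S : Set (FurstenbergBoundary X)} {ξ : FurstenbergBoundary X}
    (h : ξ ∈ closure S) (ρ : ∀ i, GeodesicRay (X i)) (hρ : ∀ i, (ρ i).endpoint = ξ i)
    (R : Fin r → ℝ≥0) (hR : ∀ i, 0 < R i) {ε : ℝ} (hε : 0 < ε) :
    ∃ η ∈ S, ∃ τ : ∀ i, GeodesicRay (X i), ∀ i, (τ i).endpoint = η i ∧ (τ i).1 0 = (ρ i).1 0 ∧
      dist ((τ i).1 (R i)) ((ρ i).1 (R i)) < ε := by
  let U : ∀ i, Set (Boundary (X i)) := fun i => Bordification.ideal ⁻¹' coneNhd (ρ i) (R i) ε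
  have hU : IsOpen (Set.univ.pi U) := isOpen_set_pi Set.finite_univ fun i _ =>
    (isOpen_coneNhd (ρ i) (hR i) hε).preimage continuous_induced_dom
  obtain ⟨η, hηU, hηS⟩ := mem_closure_iff.1 h _ hU fun i _ => by
    rw [← hρ i]; exact endpoint_mem_coneNhd _ _ hε
  choose τ hτ using fun i => ideal_mem_coneNhd.1 (hηU i trivial)
  exact ⟨η, hηS, τ, hτ⟩

lemma mem_closure_of_rays [∀ i, CNSpace (X i)] [∀ i, ProperSpace (X i)]
    {S : Set (FurstenbergBoundary X)} {ι : Type*} {F : Filter ι} [F.NeBot]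
    (ρ : ∀ i, GeodesicRay (X i)) (ζ : ι → ∀ i, GeodesicRay (X i))
    (hS : ∀ n, (fun i => (ζ n i).endpoint) ∈ S) (h0 : ∀ n i, (ζ n i).1 0 = (ρ i).1 0)
    (h : ∀ i, ∀ t : ℝ≥0, Tendsto (fun n => (ζ n i).1 t) F (𝓝 ((ρ i).1 t))) :
    (fun i => (ρ i).endpoint) ∈ closure S := by
  refine mem_closure_of_tendsto (f := fun n => fun i => (ζ n i).endpoint) (b := F)
    (tendsto_pi_nhds.2 fun i => tendsto_endpoint (ρ i) (fun n => h0 n i) (h i))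
    (Eventually.of_forall hS)

/-- The closure of an invariant set is invariant. -/
lemma smul_mem_closure [∀ i, CNSpace (X i)] [∀ i, ProperSpace (X i)]
    {S : Set (FurstenbergBoundary X)} {γ : ∀ i, X i ≃ᵢ X i} (hS : ∀ ξ ∈ S, γ • ξ ∈ S)
    {ξ : FurstenbergBoundary X} (hξ : ξ ∈ closure S) : γ • ξ ∈ closure S := by
  choose ρ hρ using fun i => exists_ray_endpoint (ξ i)
  have hR : ∀ n : ℕ, (0 : ℝ≥0) < n + 1 := fun n => by positivity
  -- Closeness `1 / (n + 1)` at time `n + 1` implies convergence at every fixed time, since rays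
  -- from a common point diverge at least linearly.
  choose η hη τ hτ using fun n : ℕ => exists_rays_of_mem_closure hξ ρ hρ (fun _ => (n : ℝ≥0) + 1)
    (fun _ => hR n) (ε := 1 / ((n : ℝ) + 1)) (by positivity)
  have key := mem_closure_of_rays (S := S) (F := atTop) (fun i => (ρ i).map (γ i))
    (fun n i => (τ n i).map (γ i)) (fun n => ?_) (fun n i => ?_) fun i t => ?_
  · convert key using 1
    funext i
    rw [map_endpoint, hρ]
    rfl
  · convert hS _ (hη n) using 1
    funext i
    rw [map_endpoint, (hτ n i).1]
    rfl
  · change γ i _ = γ i _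
    rw [(hτ n i).2.1]
  · refine ((γ i).continuous.tendsto _).comp ?_
    rw [tendsto_iff_dist_tendsto_zero]
    refine squeeze_zero' (Eventually.of_forall fun _ => dist_nonneg) ?_
      tendsto_one_div_add_atTop_nhds_zero_nat
    have hn : ∀ᶠ n : ℕ in atTop, t ≤ (n : ℝ≥0) :=
      tendsto_natCast_atTop_atTop.eventually_ge_atTop t
    filter_upwards [hn] with n hn
    have hle : t ≤ (n : ℝ≥0) + 1 := hn.trans le_self_add
    refine ((dist_ray_ray_le (hτ n i).2.1 hle).trans ?_).trans (hτ n i).2.2.le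
    exact mul_le_of_le_one_left dist_nonneg (div_le_one_of_le₀ (by exact_mod_cast hle) (NNReal.coe_nonneg _))

end Furstenberg

/-! ### Flat half-planes -/

lemma withLp_dist_sq (p q : WithLp 2 (ℝ≥0 × ℝ)) :
    dist p q ^ 2 = ((p.fst : ℝ) - q.fst) ^ 2 + (p.snd - q.snd) ^ 2 := by
  rw [WithLp.prod_dist_eq_add (by norm_num)]
  have h : 0 ≤ dist p.fst q.fst ^ 2 + dist p.snd q.snd ^ 2 := by positivity
  simp only [ENNReal.toReal_ofNat, Real.rpow_ofNat]
  rw [← Real.sqrt_eq_rpow, Real.sq_sqrt h, NNReal.dist_eq, Real.dist_eq, sq_abs, sq_abs]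

section HalfPlane

variable {X : Type*} [MetricSpace X] [CNSpace X]

omit [CNSpace X] in
lemma dist_line {σ : ℝ → X} (hσ : Isometry σ) (s t : ℝ) : dist (σ s) (σ t) = |s - t| := by
  rw [hσ.dist_eq, Real.dist_eq]

lemma seg_line {σ : ℝ → X} (hσ : Isometry σ) (a b : ℝ) {s : ℝ} (h0 : 0 ≤ s) (h1 : s ≤ 1) :
    seg (σ a) (σ b) s = σ (a + s * (b - a)) := by
  refine (eq_seg h0 h1 (le_of_eq ?_) (le_of_eq ?_)).symm
  · rw [dist_line hσ, dist_line hσ, abs_sub_comm a b,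
      show a - (a + s * (b - a)) = -(s * (b - a)) by ring, abs_neg, abs_mul, abs_of_nonneg h0]
  · rw [dist_line hσ, dist_line hσ, abs_sub_comm a b,
      show b - (a + s * (b - a)) = (1 - s) * (b - a) by ring, abs_mul,
      abs_of_nonneg (sub_nonneg.2 h1)]

lemma dist_line_sq_le {σ : ℝ → X} (hσ : Isometry σ) (t u : ℝ) (q : X) :
    dist (σ t) q ^ 2 ≤
      (dist (σ u) q ^ 2 + dist (σ (2 * t - u)) q ^ 2) / 2 - (u - t) ^ 2 := by
  have h := dist_seg_sq_le (σ u) (σ (2 * t - u)) q (s := 1 / 2) (by norm_num) (by norm_num)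
  rw [seg_line hσ _ _ (by norm_num) (by norm_num), dist_line hσ, sq_abs] at h
  rw [show u + 1 / 2 * (2 * t - u - u) = t by ring] at h
  linarith [show (u - (2 * t - u)) ^ 2 = 4 * (u - t) ^ 2 by ring]

lemma geodesicallyConvex_range {ι : WithLp 2 (ℝ≥0 × ℝ) → X} (hι : Isometry ι) :
    GeodesicallyConvex (Set.range ι) := by
  rintro τ l _ _ ⟨p, rfl⟩ ⟨q, rfl⟩ hτ t ⟨ht0, htl⟩
  rw [hτ.eq_geo ht0 htl, geo]
  have hl := hτ.dist_eq
  set s := t / dist (ι p) (ι q) with hs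
  have hs0 : 0 ≤ s := by positivity
  have hs1 : s ≤ 1 := div_dist_le_one (by rwa [hl])
  have hnn : 0 ≤ (1 - s) * (p.fst : ℝ) + s * q.fst :=
    add_nonneg (mul_nonneg (by linarith) p.fst.coe_nonneg) (mul_nonneg hs0 q.fst.coe_nonneg)
  clear_value s
  obtain ⟨w, hw⟩ : ∃ w : ℝ≥0, (w : ℝ) = (1 - s) * p.fst + s * q.fst := ⟨⟨_, hnn⟩, rfl⟩
  obtain ⟨m, hm1, hm2⟩ : ∃ m : WithLp 2 (ℝ≥0 × ℝ), m.fst = w ∧ m.snd = (1 - s) * p.snd + s * q.snd :=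
    ⟨WithLp.toLp 2 (w, _), rfl, rfl⟩
  refine ⟨m, eq_seg hs0 hs1 ?_ ?_⟩
  · rw [hι.dist_eq, hι.dist_eq]
    refine abs_le_of_sq_le_sq (le_of_eq ?_) (by positivity) |>.trans' (le_abs_self _)
    rw [mul_pow, withLp_dist_sq, withLp_dist_sq, hm1, hm2, hw]
    ring
  · rw [hι.dist_eq, hι.dist_eq]
    refine abs_le_of_sq_le_sq (le_of_eq ?_)
      (mul_nonneg (by linarith) dist_nonneg) |>.trans' (le_abs_self _)
    rw [mul_pow, withLp_dist_sq, withLp_dist_sq, hm1, hm2, hw]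
    ring

/-- A map of the half-plane which does not increase distances and is an isometry between points
and boundary points is an isometry. -/
lemma boundsFlatHalfPlane_of_dist_le {σ : ℝ → X} (I : ℝ → ℝ → X) (h0 : ∀ t, I 0 t = σ t)
    (hle : ∀ a b s t, 0 ≤ a → 0 ≤ b → dist (I a s) (I b t) ^ 2 ≤ (a - b) ^ 2 + (s - t) ^ 2)
    (hge : ∀ a s u, 0 ≤ a → a ^ 2 + (s - u) ^ 2 ≤ dist (I a s) (σ u) ^ 2) :
    BoundsFlatHalfPlane σ := by
  have hlt : ∀ a b s t, 0 ≤ a → a < b → (a - b) ^ 2 + (s - t) ^ 2 ≤ dist (I a s) (I b t) ^ 2 := by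
    intro a b s t ha hab
    have hb : 0 < b := ha.trans_lt hab
    -- `(a, s)` divides the Euclidean segment from the boundary point `(0, u)` to `(b, t)` at ratio
    -- `μ`. Subtracting the upper bound for the distance of `I a s` to `σ u` from the lower bound
    -- for that of `I b t` gives the claim.
    set μ := a / b with hμ
    have hμ0 : 0 ≤ μ := by positivity
    have hμ1 : 0 < 1 - μ := sub_pos.2 ((div_lt_one hb).2 hab)
    have ea : a = μ * b := by rw [hμ]; field_simp
    set u := (s - μ * t) / (1 - μ) with hu
    have es : s - u = μ * (t - u) := by rw [hu]; field_simp; ring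
    set N := √(b ^ 2 + (t - u) ^ 2)
    have hN : N ^ 2 = b ^ 2 + (t - u) ^ 2 := Real.sq_sqrt (by positivity)
    have hN0 : 0 ≤ N := Real.sqrt_nonneg _
    have e1 : dist (I a s) (σ u) ≤ μ * N := by
      refine abs_le_of_sq_le_sq ?_ (by positivity) |>.trans' (le_abs_self _)
      rw [← h0, mul_pow, hN]
      refine (hle a 0 s u ha le_rfl).trans (le_of_eq ?_)
      rw [es, ea]; ring
    have e2 : N ≤ dist (I b t) (σ u) := by
      refine abs_le_of_sq_le_sq ?_ dist_nonneg |>.trans' (le_abs_self _)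
      rw [hN]
      exact hge b t u hb.le
    have e3 : (1 - μ) * N ≤ dist (I a s) (I b t) := by
      have := dist_triangle_left (I b t) (σ u) (I a s)
      linarith
    have e4 := pow_le_pow_left₀ (by positivity) e3 2
    refine (le_of_eq ?_).trans e4
    rw [mul_pow, hN, show s - t = -((1 - μ) * (t - u)) by linarith, ea]
    ring
  have hge' : ∀ a b s t, 0 ≤ a → 0 ≤ b →
      (a - b) ^ 2 + (s - t) ^ 2 ≤ dist (I a s) (I b t) ^ 2 := by
    intro a b s t ha hb
    rcases lt_trichotomy a b with h | rfl | h
    · exact hlt a b s t ha h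
    · rw [sub_self, zero_pow two_ne_zero, zero_add, ← sq_abs (s - t)]
      -- At equal heights the connecting line misses the boundary; one point is raised by `ε`.
      refine pow_le_pow_left₀ (abs_nonneg _) (le_of_forall_pos_le_add fun ε hε => ?_) 2
      have e1 := hlt a (a + ε) s t ha (by linarith)
      have e2 : |s - t| ≤ dist (I a s) (I (a + ε) t) := by
        refine abs_le_of_sq_le_sq ?_ dist_nonneg
        linarith [sq_nonneg (a - (a + ε))]
      have e3 : dist (I a t) (I (a + ε) t) ≤ ε := by
        refine abs_le_of_sq_le_sq ((hle a (a + ε) t t ha (by linarith)).trans (le_of_eq ?_)) hε.le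
          |>.trans' (le_abs_self _)
        ring
      linarith [dist_triangle (I a s) (I a t) (I (a + ε) t)]
    · have := hlt b a t s hb h
      rw [dist_comm] at this
      linarith
  have hiso : Isometry fun p : WithLp 2 (ℝ≥0 × ℝ) => I p.fst p.snd := by
    refine Isometry.of_dist_eq fun p q => ?_
    refine (pow_left_inj₀ dist_nonneg dist_nonneg two_ne_zero).1 ?_
    rw [withLp_dist_sq]
    exact le_antisymm (hle _ _ _ _ p.fst.coe_nonneg q.fst.coe_nonneg)
      (hge' _ _ _ _ p.fst.coe_nonneg q.fst.coe_nonneg)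
  refine ⟨_, hiso, hiso.isClosedEmbedding.isClosed_range, geodesicallyConvex_range hiso,
    fun t => ?_⟩
  simp [h0]

/-- Rays issuing from the points of a line, at a constant angle with the line and spreading out at
most as in the Euclidean plane, form a flat half-plane. -/
lemma boundsFlatHalfPlane_of_rays {σ : ℝ → X} (hσ : Isometry σ) {c : ℝ} (hc : |c| < 1)
    (ρ : ℝ → ℝ → X) (h0 : ∀ t, ρ t 0 = σ t) (hd : ∀ t a, 0 ≤ a → dist (σ t) (ρ t a) = a)
    (hle : ∀ s t a b, 0 ≤ a → 0 ≤ b →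
      dist (ρ s a) (ρ t b) ^ 2 ≤ (s - t) ^ 2 - 2 * c * (s - t) * (a - b) + (a - b) ^ 2) :
    BoundsFlatHalfPlane σ := by
  have hk0 : 0 < 1 - c ^ 2 := by
    have := (sq_lt_one_iff_abs_lt_one c).2 hc
    linarith
  set k := √(1 - c ^ 2)
  have hk : 0 < k := Real.sqrt_pos.2 hk0
  have hk2 : k ^ 2 = 1 - c ^ 2 := Real.sq_sqrt hk0.le
  have hsq : ∀ a, a ^ 2 = (1 - c ^ 2) * (a / k) ^ 2 := fun a => by
    rw [← hk2, ← mul_pow, mul_div_cancel₀ _ hk.ne']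
  -- In the model half-plane the ray from `σ t` reaches height `k * b` over the foot point `t - c *
  -- b` at time `b`. Solving for height `a` over a given foot point yields these orthogonal
  -- coordinates.
  refine boundsFlatHalfPlane_of_dist_le (fun a t => ρ (t + c * (a / k)) (a / k)) (fun t => ?_)
    (fun a b s t ha hb => ?_) fun a s u ha => ?_
  · simp [h0]
  · refine (hle _ _ _ _ (by positivity) (by positivity)).trans (le_of_eq ?_)
    rw [hsq (a - b), sub_div]
    ring
  · set b := a / k with hb
    have hb0 : 0 ≤ b := by positivity
    set t := s + c * b with ht
    -- `σ t` is the midpoint of `σ u` and `σ (2 * t - u)`, so the upper bound at the reflected point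
    -- becomes a lower bound at `σ u`.
    have e1 := dist_line_sq_le hσ t u (ρ t b)
    have e2 := hle (2 * t - u) t 0 b le_rfl hb0
    rw [hd t b hb0] at e1
    rw [h0] at e2
    change a ^ 2 + (s - u) ^ 2 ≤ dist (ρ t b) (σ u) ^ 2
    rw [dist_comm, hsq, ← hb]
    have e3 : (1 - c ^ 2) * b ^ 2 + (s - u) ^ 2 = b ^ 2 + (u - t) ^ 2 + 2 * c * (u - t) * b := by
      rw [ht]; ring
    rw [e3]
    linarith

/-- This rests on `f² - g² = (f - g)² + 2 g (f - g)`. -/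
lemma tendsto_sq_sub_sq_div {ι : Type*} {F : Filter ι} {f g : ι → ℝ} {d : ℝ}
    (hg : Tendsto g F atTop) (h : Tendsto (fun i => f i - g i) F (𝓝 d)) :
    Tendsto (fun i => (f i ^ 2 - g i ^ 2) / g i) F (𝓝 (2 * d)) := by
  have h1 : Tendsto (fun i => (f i - g i) ^ 2 / g i + 2 * (f i - g i)) F (𝓝 (0 + 2 * d)) :=
    ((h.pow 2).div_atTop hg).add (h.const_mul 2)
  rw [zero_add] at h1
  refine h1.congr' ?_
  filter_upwards [hg.eventually_gt_atTop 0] with i hi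
  field_simp
  ring

/-- If the distance functions to `y i` restricted to the line `σ` are asymptotically affine of slope
in `(-1, 1)` then `σ` bounds a flat half-plane. -/
lemma boundsFlatHalfPlane_of_tendsto [ProperSpace X] {σ : ℝ → X} (hσ : Isometry σ) {ι : Type*}
    {F : Filter ι} [F.NeBot] (y : ι → X) {c : ℝ} (hc : |c| < 1)
    (h0 : Tendsto (fun i => dist (σ 0) (y i)) F atTop)
    (h : ∀ t, Tendsto (fun i => dist (σ t) (y i) - dist (σ 0) (y i)) F (𝓝 (c * t))) :
    BoundsFlatHalfPlane σ := by
  set u := Ultrafilter.of F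
  replace h0 := h0.mono_left (Ultrafilter.of_le F)
  replace h := fun t => (h t).mono_left (Ultrafilter.of_le F)
  have hfar : ∀ t, Tendsto (fun i => dist (σ t) (y i)) u atTop := fun t =>
    tendsto_dist_of_tendsto_dist _ h0
  have hdiff : ∀ s t, Tendsto (fun i => dist (σ s) (y i) - dist (σ t) (y i)) u
      (𝓝 (c * (s - t))) := fun s t => by
    have := (h s).sub (h t)
    rw [← mul_sub] at this
    refine this.congr fun i => by ring
  choose ρ hρ0 hρ using fun t => exists_ray_of_tendsto u (σ t) y (hfar t)
  refine boundsFlatHalfPlane_of_rays hσ hc (fun t a => (ρ t).1 a.toNNReal) (fun t => ?_)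
    (fun t a ha => ?_) fun s t a b ha hb => ?_
  · simp [hρ0]
  · rw [← hρ0, (ρ t).dist_zero, Real.coe_toNNReal a ha]
  have ha' := hρ s a.toNNReal
  have hb' := hρ t b.toNNReal
  rw [Real.coe_toNNReal _ ha] at ha'
  rw [Real.coe_toNNReal _ hb] at hb'
  set f := fun i => dist (σ s) (y i) with hf
  set g := fun i => dist (σ t) (y i) with hg
  -- Bruhat–Tits once for each of the two segments, arranged so that every quotient on the right has
  -- a limit.
  have key : ∀ᶠ i in u, dist (geo (σ s) (y i) a) (geo (σ t) (y i) b) ^ 2 ≤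
      (1 - a / f i) * ((1 - b / g i) * (s - t) ^ 2 + b * ((f i ^ 2 - g i ^ 2) / g i) + b ^ 2) +
        a * (((g i - b) ^ 2 - f i ^ 2) / f i) + a ^ 2 := by
    filter_upwards [(hfar s).eventually_gt_atTop a, (hfar t).eventually_gt_atTop b] with i hfi hgi
    have hf0 : 0 < f i := ha.trans_lt hfi
    have hg0 : 0 < g i := hb.trans_lt hgi
    have e1 := dist_seg_sq_le (σ s) (y i) (geo (σ t) (y i) b) (s := a / f i) (by positivity)
      ((div_le_one hf0).2 hfi.le)
    have e2 := dist_seg_sq_le (σ t) (y i) (σ s) (s := b / g i) (by positivity)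
      ((div_le_one hg0).2 hgi.le)
    rw [dist_comm (y i), dist_geo_right hb hgi.le] at e1
    rw [dist_line hσ, sq_abs, dist_comm (y i), dist_comm] at e2
    have h1 : 0 ≤ 1 - a / f i := sub_nonneg.2 ((div_le_one hf0).2 hfi.le)
    have e3 := mul_le_mul_of_nonneg_left e2 h1
    change _ ≤ _ * ((1 - b / g i) * (t - s) ^ 2 + b / g i * f i ^ 2 -
      b / g i * (1 - b / g i) * g i ^ 2) at e3
    change _ ≤ (1 - a / f i) * dist (σ s) (seg (σ t) (y i) (b / g i)) ^ 2 +
      a / f i * (g i - b) ^ 2 - a / f i * (1 - a / f i) * f i ^ 2 at e1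
    change dist (seg (σ s) (y i) (a / f i)) (geo (σ t) (y i) b) ^ 2 ≤ _
    have e4 : b / g i * f i ^ 2 - b / g i * (1 - b / g i) * g i ^ 2 =
      b * ((f i ^ 2 - g i ^ 2) / g i) + b ^ 2 := by field_simp; ring
    have e5 : a / f i * (g i - b) ^ 2 - a / f i * (1 - a / f i) * f i ^ 2 =
      a * (((g i - b) ^ 2 - f i ^ 2) / f i) + a ^ 2 := by field_simp; ring
    rw [add_sub_assoc, e4] at e3
    rw [add_sub_assoc, e5] at e1
    linarith [show (t - s) ^ 2 = (s - t) ^ 2 by ring]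
  have l1 : Tendsto (fun i => 1 - a / f i) u (𝓝 (1 - 0)) :=
    tendsto_const_nhds.sub (tendsto_const_nhds.div_atTop (hfar s))
  have l2 : Tendsto (fun i => 1 - b / g i) u (𝓝 (1 - 0)) :=
    tendsto_const_nhds.sub (tendsto_const_nhds.div_atTop (hfar t))
  have l3 := tendsto_sq_sub_sq_div (hfar t) (hdiff s t)
  have l4 : Tendsto (fun i => ((g i - b) ^ 2 - f i ^ 2) / f i) u (𝓝 (2 * (c * (t - s) - b))) :=
    tendsto_sq_sub_sq_div (hfar s) (((hdiff t s).sub_const b).congr fun i => by ring)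
  have l5 := (l1.mul (((l2.mul_const ((s - t) ^ 2)).add (l3.const_mul b)).add_const (b ^ 2))).add
    (l4.const_mul a) |>.add_const (a ^ 2)
  have l6 := le_of_tendsto_of_tendsto ((ha'.dist hb').pow 2) l5 key
  refine l6.trans (le_of_eq ?_)
  ring

end HalfPlane

/-! ### Convex functions on the line -/

/-- A strict increase from `s` to `t` continues beyond `t` at least linearly, and `K` is chosen so
that the bound `C` would be exceeded at `s + K * (t - s)`. -/
lemma eq_of_convexOn_of_le {f : ℝ → ℝ} (hf : ConvexOn ℝ Set.univ f) {C : ℝ} (h : ∀ t, f t ≤ C)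
    (s t : ℝ) : f s = f t := by
  wlog hlt : f s < f t generalizing s t
  · by_contra hne
    rcases lt_or_gt_of_ne hne with h' | h'
    · exact hne (this s t h')
    · exact hne (this t s h').symm
  exfalso
  have hst : s ≠ t := fun e => by simp [e] at hlt
  set d := f t - f s with hd
  have hd0 : 0 < d := sub_pos.2 hlt
  set K := max ((C - f s) / d + 1) 1 with hK
  have hK1 : 1 ≤ K := le_max_right _ _
  have hK0 : 0 < K := by linarith
  have h1K : 0 ≤ 1 - 1 / K := sub_nonneg.2 ((div_le_one hK0).2 hK1)
  have key := hf.2 (Set.mem_univ s) (Set.mem_univ (s + K * (t - s))) h1K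
    (show 0 ≤ 1 / K by positivity) (by ring)
  simp only [smul_eq_mul] at key
  rw [show (1 - 1 / K) * s + 1 / K * (s + K * (t - s)) = t by field_simp; ring] at key
  have h1 := mul_le_mul_of_nonneg_left (h (s + K * (t - s))) (show 0 ≤ 1 / K by positivity)
  have h2 : K * d ≤ C - f s := by
    have h3 : d ≤ 1 / K * (C - f s) := by rw [hd]; linarith
    have := mul_le_mul_of_nonneg_left h3 hK0.le
    rwa [← mul_assoc, mul_one_div_cancel hK0.ne', one_mul] at this
  have h4 : (C - f s) / d + 1 ≤ K := le_max_left _ _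
  have h5 := mul_le_mul_of_nonneg_right h4 hd0.le
  rw [add_mul, div_mul_cancel₀ _ hd0.ne'] at h5
  linarith

/-- The increments of a nondecreasing convex function become linear at `-∞`. -/
lemma exists_tendsto_sub_of_convexOn {f : ℝ → ℝ} (hf : ConvexOn ℝ Set.univ f) (hm : Monotone f) :
    ∃ c : ℝ, 0 ≤ c ∧ (∀ s t, s < t → c ≤ (f t - f s) / (t - s)) ∧
      ∀ t, Tendsto (fun x => f (x + t) - f x) atBot (𝓝 (c * t)) := by
  have hslope : ∀ x y z, x < y → y < z → (f y - f x) / (y - x) ≤ (f z - f y) / (z - y) :=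
    fun x y z => hf.slope_mono_adjacent trivial trivial
  have hslope' : ∀ a b x y, a < b → b ≤ x → x < y → (f b - f a) / (b - a) ≤ (f y - f x) / (y - x) := by
    intro a b x y h1 h2 h3
    rcases h2.eq_or_lt with rfl | h2
    · exact hslope _ _ _ h1 h3
    · exact (hslope _ _ _ h1 h2).trans (hslope _ _ _ h2 h3)
  -- Unit increments are monotone and nonnegative, so they converge at `-∞`; increments over any `t
  -- > 0` are squeezed between two multiples of them.
  set q : ℝ → ℝ := fun x => f x - f (x - 1) with hq
  have hq' : ∀ x, q x = (f x - f (x - 1)) / (x - (x - 1)) := fun x => by simp [hq]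
  have hq0 : ∀ x, 0 ≤ q x := fun x => sub_nonneg.2 (hm (by linarith))
  have hqm : Monotone q := by
    intro x y hxy
    rcases hxy.eq_or_lt with rfl | hxy
    · rfl
    by_cases h : x ≤ y - 1
    · rw [hq', hq']; exact hslope' _ _ _ _ (by linarith) h (by linarith)
    · push Not at h
      have a := hslope (x - 1) (y - 1) x (by linarith) (by linarith)
      have b := hslope (y - 1) x y (by linarith) hxy
      have c := (a.trans b)
      have e1 : y - 1 - (x - 1) = y - x := by ring
      rw [e1] at c
      have := (div_le_div_iff_of_pos_right (sub_pos.2 hxy)).1 c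
      simp only [hq]
      linarith
  have hbdd : BddBelow (Set.range q) := ⟨0, by rintro _ ⟨x, rfl⟩; exact hq0 x⟩
  set c := ⨅ x, q x
  have hlim : Tendsto q atBot (𝓝 c) := tendsto_atBot_ciInf hqm hbdd
  have hcle : ∀ x, c ≤ q x := fun x => ciInf_le hbdd x
  have hpos : ∀ t, 0 < t → Tendsto (fun x => f (x + t) - f x) atBot (𝓝 (c * t)) := by
    intro t ht
    have h1 : Tendsto (fun x => q (x + t + 1) * t) atBot (𝓝 (c * t)) := by
      refine (hlim.comp ?_).mul_const t
      exact tendsto_atBot_add_const_right _ _ (tendsto_atBot_add_const_right _ _ tendsto_id)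
    refine tendsto_of_tendsto_of_tendsto_of_le_of_le (hlim.mul_const t) h1 (fun x => ?_) fun x => ?_
    · have := hslope (x - 1) x (x + t) (by linarith) (by linarith)
      rw [← hq', add_sub_cancel_left, le_div_iff₀ ht] at this
      exact this
    · have := hslope x (x + t) (x + t + 1) (by linarith) (by linarith)
      rw [add_sub_cancel_left, add_sub_cancel_left, div_one, div_le_iff₀ ht] at this
      simpa [hq] using this
  refine ⟨c, le_ciInf hq0, fun s t hst => ?_, fun t => ?_⟩
  · refine (hcle s).trans ?_
    rw [hq']
    exact hslope _ _ _ (by linarith) hst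
  · rcases lt_trichotomy t 0 with h | rfl | h
    · have := ((hpos (-t) (by linarith)).comp
        (tendsto_atBot_add_const_right atBot t tendsto_id)).neg
      rw [mul_neg, neg_neg] at this
      refine this.congr fun x => ?_
      simp
    · simp
    · exact hpos t h

/-- The filter `F.curry G` expresses iterated limits: the second index runs off first, at a rate
depending on the first index. -/
lemma curry_neBot {α β : Type*} (F : Filter α) (G : Filter β) [F.NeBot] [G.NeBot] :
    (F.curry G).NeBot := by
  refine ⟨fun H => ?_⟩
  have hf : ∀ᶠ _ in F.curry G, False := by simp [H]
  obtain ⟨k, hk⟩ := (eventually_curry_iff.1 hf).exists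
  exact hk.exists.elim fun _ h => h

/-! ### Closest points on a line -/

section Line

variable {X : Type*} [MetricSpace X]

/-- `σ s` is a point of the line `σ` closest to `y`. -/
def IsProj (σ : ℝ → X) (y : X) (s : ℝ) : Prop := ∀ t, dist (σ s) y ≤ dist (σ t) y

lemma exists_isProj {σ : ℝ → X} (hσ : Isometry σ) (y : X) : ∃ s, IsProj σ y s := by
  refine Continuous.exists_forall_le (hσ.continuous.dist continuous_const) ?_
  refine tendsto_atTop_mono (fun t => ?_) (tendsto_atTop_add_const_right _ (-dist (σ 0) y)
    (tendsto_norm_cocompact_atTop (E := ℝ)))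
  have := dist_triangle_right (σ t) (σ 0) y
  rw [hσ.dist_eq, Real.dist_eq, sub_zero] at this
  rw [Real.norm_eq_abs]
  linarith

lemma IsProj.abs_le {σ : ℝ → X} (hσ : Isometry σ) {y : X} {s : ℝ} (h : IsProj σ y s) :
    |s| ≤ 2 * dist (σ 0) y := by
  have a := dist_triangle_right (σ s) (σ 0) y
  rw [hσ.dist_eq, Real.dist_eq, sub_zero] at a
  linarith [h 0]

lemma IsProj.map {σ : ℝ → X} {h : X ≃ᵢ X} {l : ℝ} (hh : ∀ t, h (σ t) = σ (t + l)) {y : X} {s : ℝ}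
    (hy : IsProj σ y s) : IsProj σ (h y) (s + l) := by
  intro t
  rw [← hh, h.dist_eq, ← sub_add_cancel t l, ← hh, h.dist_eq]
  exact hy _

lemma IsProj.reverse {σ : ℝ → X} {y : X} {s : ℝ} (hy : IsProj σ y s) :
    IsProj (fun t => σ (-t)) y (-s) := by
  intro t
  simpa using hy (-t)

lemma isometry_reverse {σ : ℝ → X} (hσ : Isometry σ) : Isometry fun t => σ (-t) :=
  hσ.comp (IsometryEquiv.neg ℝ).isometry

lemma inv_translate {σ : ℝ → X} {h : X ≃ᵢ X} {l : ℝ} (hh : ∀ t, h (σ t) = σ (t + l)) (t : ℝ) :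
    h⁻¹ (σ t) = σ (t - l) := by
  have := hh (t - l)
  rw [sub_add_cancel] at this
  rw [← this]
  exact h.symm_apply_apply _

lemma pow_translate {σ : ℝ → X} {h : X ≃ᵢ X} {l : ℝ} (hh : ∀ t, h (σ t) = σ (t + l)) (n : ℕ)
    (t : ℝ) : (h ^ n) (σ t) = σ (t + n * l) := by
  induction n generalizing t with
  | zero => simp
  | succ n ih =>
    rw [pow_succ, IsometryEquiv.mul_apply, hh, ih]
    congr 1
    push_cast
    ring

variable [CNSpace X]

lemma BoundsFlatHalfPlane.reverse {σ : ℝ → X} (h : BoundsFlatHalfPlane fun t => σ (-t)) :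
    BoundsFlatHalfPlane σ := by
  obtain ⟨ι, hι, -, -, h0⟩ := h
  have hiso : Isometry fun p : WithLp 2 (ℝ≥0 × ℝ) => ι (WithLp.toLp 2 (p.fst, -p.snd)) := by
    refine Isometry.of_dist_eq fun p q => ?_
    rw [hι.dist_eq]
    refine (pow_left_inj₀ dist_nonneg dist_nonneg two_ne_zero).1 ?_
    rw [withLp_dist_sq, withLp_dist_sq]
    change ((p.fst : ℝ) - q.fst) ^ 2 + (-p.snd - -q.snd) ^ 2 = _
    ring
  refine ⟨_, hiso, hiso.isClosedEmbedding.isClosed_range, geodesicallyConvex_range hiso, fun t => ?_⟩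
  have := h0 (-t)
  simp only [neg_neg] at this
  exact this

lemma seg_self (x : X) {s : ℝ} (h0 : 0 ≤ s) (h1 : s ≤ 1) : seg x x s = x :=
  (eq_seg h0 h1 (by simp) (by simp)).symm

lemma convexOn_dist_line_line {σ τ : ℝ → X} (hσ : Isometry σ) (hτ : Isometry τ) :
    ConvexOn ℝ Set.univ fun t => dist (σ t) (τ t) := by
  refine ⟨convex_univ, fun x _ y _ a b ha hb hab => ?_⟩
  obtain rfl : a = 1 - b := by linarith
  have := dist_seg_seg (σ x) (σ y) (τ x) (τ y) hb (by linarith)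
  rw [seg_line hσ _ _ hb (by linarith), seg_line hτ _ _ hb (by linarith)] at this
  simp only [smul_eq_mul]
  rwa [show (1 - b) * x + b * y = x + b * (y - x) by ring]

lemma convexOn_dist_line {σ : ℝ → X} (hσ : Isometry σ) (q : X) :
    ConvexOn ℝ Set.univ fun t => dist (σ t) q := by
  refine ⟨convex_univ, fun x _ y _ a b ha hb hab => ?_⟩
  obtain rfl : a = 1 - b := by linarith
  have := dist_seg_seg (σ x) (σ y) q q hb (by linarith)
  rw [seg_line hσ _ _ hb (by linarith), seg_self q hb (by linarith)] at this
  simp only [smul_eq_mul]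
  rwa [show (1 - b) * x + b * y = x + b * (y - x) by ring]

lemma IsProj.seg {σ : ℝ → X} {y : X} {s : ℝ} (h : IsProj σ y s) {u : ℝ} (h0 : 0 ≤ u) (h1 : u ≤ 1) :
    IsProj σ (seg (σ s) y u) s := by
  intro t
  have a := dist_triangle (σ t) (HadamardProduct.seg (σ s) y u) y
  rw [dist_left_seg _ _ h0 h1]
  rw [dist_seg_right _ _ h0 h1] at a
  linarith [h t]

lemma dist_seg_seg_param (x y : X) {s t : ℝ} (hs0 : 0 ≤ s) (hs1 : s ≤ 1) (ht0 : 0 ≤ t)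
    (ht1 : t ≤ 1) : dist (seg x y s) (seg x y t) = |s - t| * dist x y := by
  wlog hst : s ≤ t generalizing s t
  · rw [dist_comm, this ht0 ht1 hs0 hs1 (le_of_not_ge hst), abs_sub_comm]
  rcases ht0.eq_or_lt with rfl | ht
  · have : s = 0 := by linarith
    simp [this]
  rw [dist_seg_left_seg_left x y hs0 hst ht1, dist_seg_right _ _ (by positivity)
    ((div_le_one ht).2 hst), dist_left_seg _ _ ht0 ht1, abs_sub_comm, abs_of_nonneg (by linarith),
    ← mul_assoc, sub_mul, one_mul, div_mul_cancel₀ _ ht.ne']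

/-- A lower bound uniform in `y`. Writing `dist p y = f - t + e`, Bruhat–Tits at `geo o y t` gives
`ε² f ≤ t (2 e (f - t) + e²)`, and this is at most `2 t e f` because `0 ≤ e ≤ 2 t`. -/
lemma add_le_dist_of_le_dist_geo {o p y : X} {t ε : ℝ} (ht : 0 < t) (hε : 0 < ε)
    (hp : dist o p = t) (hy : t ≤ dist o y) (h : ε ≤ dist (geo o y t) p) :
    dist o y - t + ε ^ 2 / (2 * t) ≤ dist p y := by
  have h1 := dist_seg_sq_le o y p (s := t / dist o y) (by positivity) (div_dist_le_one hy)
  change dist (geo o y t) p ^ 2 ≤ _ at h1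
  have h2 := pow_le_pow_left₀ hε.le h 2
  have h3 := dist_triangle_left p y o
  rw [hp, dist_comm y p] at h1
  rw [hp] at h3
  have h4 := dist_triangle o p y
  rw [hp] at h4
  set f := dist o y with hf
  have hf0 : 0 < f := ht.trans_le hy
  obtain ⟨e, he⟩ : ∃ e, dist p y = f - t + e := ⟨dist p y - f + t, by ring⟩
  rw [he] at h1 h3 h4 ⊢
  have h5 := mul_le_mul_of_nonneg_right (h2.trans h1) hf0.le
  have h6 : ((1 - t / f) * t ^ 2 + t / f * (f - t + e) ^ 2 - t / f * (1 - t / f) * f ^ 2) * f =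
      t * (2 * e * (f - t) + e ^ 2) := by
    field_simp
    ring
  rw [h6] at h5
  have he0 : 0 ≤ e := by linarith
  have he2 : e ≤ 2 * t := by linarith
  have h7 : ε ^ 2 * f ≤ 2 * t * e * f := by
    nlinarith [mul_nonneg (mul_nonneg ht.le he0) (sub_nonneg.2 he2)]
  have h8 := le_of_mul_le_mul_right h7 hf0
  have : ε ^ 2 / (2 * t) ≤ e := by rw [div_le_iff₀ (by positivity)]; linarith
  linarith

omit [CNSpace X] in
lemma tendsto_dist_of_isProj_atBot {σ : ℝ → X} (hσ : Isometry σ) {ι : Type*} {F : Filter ι}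
    {y : ι → X} {s : ι → ℝ} (hs : ∀ i, IsProj σ (y i) (s i)) (hlim : Tendsto s F atBot) :
    Tendsto (fun i => dist (σ 0) (y i)) F atTop := by
  refine tendsto_atTop_mono (fun i => ?_)
    ((tendsto_neg_atBot_atTop.comp hlim).atTop_div_const (r := 2) two_pos)
  have := (hs i).abs_le hσ
  simp only [Function.comp]
  linarith [neg_le_abs (s i)]

variable [ProperSpace X]

/-- Points whose projections to a rank one axis go to one end of the axis converge to this end. -/
lemma tendsto_geo_of_isProj_atBot {σ : ℝ → X} (hσ : Isometry σ) {h : X ≃ᵢ X} {l : ℝ} (hl : 0 < l)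
    (hh : ∀ t, h (σ t) = σ (t + l)) (hr : ¬ BoundsFlatHalfPlane σ) {ι : Type*} {F : Filter ι}
    {y : ι → X} {s : ι → ℝ} (hs : ∀ i, IsProj σ (y i) (s i)) (hlim : Tendsto s F atBot)
    {t : ℝ} (ht : 0 ≤ t) : Tendsto (fun i => geo (σ 0) (y i) t) F (𝓝 (σ (-t))) := by
  -- Along an ultrafilter bounded functions have limits, and failure of convergence becomes a gap
  -- `ε` that holds eventually.
  rw [tendsto_iff_ultrafilter]
  intro u hu
  replace hlim := hlim.mono_left hu
  rcases ht.eq_or_lt with rfl | ht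
  · simp
  by_contra hcon
  refine hr ?_
  have hfar := tendsto_dist_of_isProj_atBot hσ hs hlim
  rw [Metric.tendsto_nhds] at hcon
  push Not at hcon
  obtain ⟨ε, hε, hcon⟩ := hcon
  -- The limit `B` of the normalized distance functions to `y i` is a horofunction restricted to the
  -- axis.
  have hB : ∀ a, ∃ b, Tendsto (fun i => dist (σ a) (y i) - dist (σ 0) (y i)) u (𝓝 b) := fun a =>
    exists_tendsto_of_bounded u _ 0 |a| (Eventually.of_forall fun i => by
      rw [Real.dist_eq, zero_sub, abs_neg]
      have := abs_dist_sub_le (σ a) (σ 0) (y i)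
      rwa [dist_line hσ, sub_zero] at this)
  choose B hB using hB
  have hB0 : B 0 = 0 := tendsto_nhds_unique (hB 0) (by simp)
  have hconv : ConvexOn ℝ Set.univ B := by
    refine ⟨convex_univ, fun a _ b _ p q hp hq hpq => ?_⟩
    refine le_of_tendsto_of_tendsto' (hB _) (((hB a).const_smul p).add ((hB b).const_smul q))
      fun i => ?_
    have := (convexOn_dist_line hσ (y i)).2 (Set.mem_univ a) (Set.mem_univ b) hp hq hpq
    simp only [smul_eq_mul] at this ⊢
    obtain rfl : p = 1 - q := by linarith
    linarith
  -- As soon as `s i ≤ a`, the convex function `dist (σ ·) (y i)` has its minimum to the left of `a`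
  -- and is nondecreasing from there on.
  have hmono : Monotone B := by
    intro a b hab
    refine le_of_tendsto_of_tendsto (hB a) (hB b) ?_
    filter_upwards [hlim.eventually_le_atBot a] with i hi
    have := (convexOn_dist_line hσ (y i)).le_max_of_mem_Icc (Set.mem_univ (s i)) (Set.mem_univ b)
      (z := a) ⟨hi, hab⟩
    rw [max_eq_right (hs i b)] at this
    linarith
  obtain ⟨c, hc0, hc, hclim⟩ := exists_tendsto_sub_of_convexOn hconv hmono
  -- Because of the gap, `B` rises by less than `t` on `[-t, 0]`; so its slope `c` at `-∞` is less
  -- than `1`.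
  have hBt : -t + ε ^ 2 / (2 * t) ≤ B (-t) := by
    refine ge_of_tendsto (hB (-t)) ?_
    filter_upwards [hcon, hfar.eventually_ge_atTop t] with i h1 h2
    have := add_le_dist_of_le_dist_geo ht hε
      (by rw [dist_line hσ, sub_neg_eq_add, zero_add, abs_of_pos ht]) h2 h1
    linarith
  have hc1 : c < 1 := by
    have := hc (-t) 0 (by linarith)
    rw [hB0, zero_sub, zero_sub, neg_neg, le_div_iff₀ ht] at this
    have h2 : 0 < ε ^ 2 / (2 * t) := by positivity
    nlinarith
  have hdist : ∀ (k : ℕ) (a : ℝ) (i : ι),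
      dist (σ a) ((h ^ k) (y i)) = dist (σ (-(k * l) + a)) (y i) := fun k a i => by
    rw [← (h ^ k).dist_eq (σ (-(k * l) + a)), pow_translate hh]
    congr 2
    ring
  have := curry_neBot (atTop : Filter ℕ) (u : Filter ι)
  -- Translation by `h ^ k` shifts the distance functions by `k * l`. Letting `i` run off first and
  -- then `k`, only the asymptotic slope `c` of `B` survives.
  refine boundsFlatHalfPlane_of_tendsto hσ (F := (atTop : Filter ℕ).curry (u : Filter ι))
    (fun p => (h ^ p.1) (y p.2)) (c := c) (by rw [abs_of_nonneg hc0]; exact hc1) ?_ fun a => ?_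
  · rw [tendsto_atTop]
    intro b
    refine eventually_curry_iff.2 (Eventually.of_forall fun k => ?_)
    simp only [hdist]
    exact (tendsto_dist_of_tendsto_dist _ hfar).eventually_ge_atTop b
  · rw [Metric.tendsto_nhds]
    intro δ hδ
    refine eventually_curry_iff.2 ?_
    have hk : Tendsto (fun k : ℕ => -((k : ℝ) * l)) atTop atBot :=
      tendsto_neg_atTop_atBot.comp (tendsto_natCast_atTop_atTop.atTop_mul_const hl)
    filter_upwards [Metric.tendsto_nhds.1 ((hclim a).comp hk) δ hδ] with k hk
    have hlim2 := (hB (-(k * l) + a)).sub (hB (-(k * l) + 0))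
    rw [add_zero] at hlim2
    filter_upwards [(hlim2.dist tendsto_const_nhds).eventually_lt_const hk] with i hi
    simp only [hdist, add_zero]
    rwa [sub_sub_sub_cancel_right] at hi

lemma tendsto_geo_of_isProj_atTop {σ : ℝ → X} (hσ : Isometry σ) {h : X ≃ᵢ X} {l : ℝ} (hl : 0 < l)
    (hh : ∀ t, h (σ t) = σ (t + l)) (hr : ¬ BoundsFlatHalfPlane σ) {ι : Type*} {F : Filter ι}
    {y : ι → X} {s : ι → ℝ} (hs : ∀ i, IsProj σ (y i) (s i)) (hlim : Tendsto s F atTop)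
    {t : ℝ} (ht : 0 ≤ t) : Tendsto (fun i => geo (σ 0) (y i) t) F (𝓝 (σ t)) := by
  have := tendsto_geo_of_isProj_atBot (isometry_reverse hσ) (h := h⁻¹) hl
    (fun t => by rw [inv_translate hh]; congr 1; ring) (fun H => hr H.reverse)
    (fun i => (hs i).reverse) (tendsto_neg_atTop_atBot.comp hlim) ht
  simpa using this

end Line

/-! ### Segments between points with distant projections -/

section Contracting

variable {X : Type*} [MetricSpace X] [CNSpace X]

lemma continuousOn_seg (x y : X) : ContinuousOn (seg x y) (Set.Icc 0 1) := by
  refine (LipschitzOnWith.of_dist_le_mul (K := (dist x y).toNNReal) fun s hs t ht => ?_).continuousOn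
  rw [dist_seg_seg_param x y hs.1 hs.2 ht.1 ht.2, Real.coe_toNNReal _ dist_nonneg, mul_comm,
    Real.dist_eq]

/-- If a segment misses a ball around a point of the line, then moving the endpoints towards their
projections one obtains a segment at a prescribed smaller distance from this point. -/
lemma exists_seg_dist_eq {σ : ℝ → X} (hσ : Isometry σ) {y z : X} {s t R : ℝ} (hy : IsProj σ y s)
    (hz : IsProj σ z t) (hs : s ≤ 0) (ht : 0 ≤ t) (hR : 0 ≤ R)
    (h : ∀ a ∈ Set.Icc (0 : ℝ) 1, R ≤ dist (σ 0) (seg y z a)) :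
    ∃ y' z' : X, IsProj σ y' s ∧ IsProj σ z' t ∧ ∃ a ∈ Set.Icc (0 : ℝ) 1,
      dist (σ 0) (seg y' z' a) = R ∧ ∀ b ∈ Set.Icc (0 : ℝ) 1, R ≤ dist (σ 0) (seg y' z' b) := by
  set Y : ℝ → X := seg (σ s) y with hY
  set Z : ℝ → X := seg (σ t) z with hZ
  set S : ℝ → Set X := fun u => seg (Y u) (Z u) '' Set.Icc 0 1 with hS
  have hScpt : ∀ u, IsCompact (S u) := fun u => isCompact_Icc.image_of_continuousOn (continuousOn_seg _ _)
  have hSne : ∀ u, (S u).Nonempty := fun u => ⟨_, Set.mem_image_of_mem _ ⟨le_rfl, zero_le_one⟩⟩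
  set G : ℝ → ℝ := fun u => Metric.infDist (σ 0) (S u) with hG
  have hmin : ∀ u, ∃ a ∈ Set.Icc (0 : ℝ) 1, G u = dist (σ 0) (seg (Y u) (Z u) a) := fun u => by
    obtain ⟨_, ⟨a, ha, rfl⟩, h⟩ := (hScpt u).exists_infDist_eq_dist (hSne u) (σ 0)
    exact ⟨a, ha, h⟩
  have hle : ∀ u, ∀ a ∈ Set.Icc (0 : ℝ) 1, G u ≤ dist (σ 0) (seg (Y u) (Z u) a) := fun u a ha =>
    Metric.infDist_le_dist_of_mem (Set.mem_image_of_mem _ ha)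
  have hcont : ContinuousOn G (Set.Icc 0 1) := by
    refine (LipschitzOnWith.of_le_add_mul (dist (σ s) y + dist (σ t) z).toNNReal
      fun u hu v hv => ?_).continuousOn
    obtain ⟨a, ha, hGa⟩ := hmin v
    rw [Real.coe_toNNReal _ (by positivity), hGa]
    refine (hle u a ha).trans ?_
    have h1 := dist_triangle (σ 0) (seg (Y v) (Z v) a) (seg (Y u) (Z u) a)
    have h2 := dist_seg_seg (Y v) (Z v) (Y u) (Z u) ha.1 ha.2
    rw [hY, hZ, dist_seg_seg_param _ _ hv.1 hv.2 hu.1 hu.2,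
      dist_seg_seg_param _ _ hv.1 hv.2 hu.1 hu.2, abs_sub_comm, ← Real.dist_eq] at h2
    have h3 : (1 - a) * (dist u v * dist (σ s) y) ≤ dist u v * dist (σ s) y :=
      mul_le_of_le_one_left (by positivity) (by linarith [ha.1])
    have h4 : a * (dist u v * dist (σ t) z) ≤ dist u v * dist (σ t) z :=
      mul_le_of_le_one_left (by positivity) ha.2
    linarith
  -- At `u = 0` the segment runs inside the line and contains `σ 0`, as `s ≤ 0 ≤ t`; at `u = 1` it
  -- is the given segment.
  have hG0 : G 0 = 0 := by
    refine le_antisymm ?_ Metric.infDist_nonneg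
    by_cases hst : t - s = 0
    · have := hle 0 0 ⟨le_rfl, zero_le_one⟩
      have hs0 : s = 0 := by linarith
      simpa [hY, hs0] using this
    · have hst' : 0 < t - s := lt_of_le_of_ne (by linarith) (Ne.symm hst)
      have hq : -s / (t - s) ∈ Set.Icc (0 : ℝ) 1 :=
        ⟨div_nonneg (by linarith) hst'.le, (div_le_one hst').2 (by linarith)⟩
      have := hle 0 _ hq
      simp only [hY, hZ, seg_zero] at this
      rw [seg_line hσ _ _ hq.1 hq.2, div_mul_cancel₀ _ hst, add_neg_cancel, dist_self] at this
      exact this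
  have hG1 : R ≤ G 1 := by
    obtain ⟨a, ha, hGa⟩ := hmin 1
    rw [hGa]
    simpa [hY, hZ] using h a ha
  obtain ⟨u, hu, hGu⟩ := intermediate_value_Icc zero_le_one hcont ⟨hG0.le.trans hR, hG1⟩
  obtain ⟨a, ha, hGa⟩ := hmin u
  exact ⟨Y u, Z u, hy.seg hu.1 hu.2, hz.seg hu.1 hu.2, a, ha, hGa ▸ hGu,
    fun b hb => hGu ▸ hle u b hb⟩

/-- A point closest to `σ 0` on a line parallel to `σ`. -/
lemma dist_parallel {σ c : ℝ → X} (hσ : Isometry σ) (hc : Isometry c) {C R : ℝ}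
    (hC : ∀ t, dist (σ t) (c t) ≤ C) (h0 : dist (σ 0) (c 0) = R)
    (hR : ∀ t, R ≤ dist (σ 0) (c t)) (t : ℝ) :
    R ≤ dist (σ t) (c 0) ∧ dist (σ t) (c 0) ^ 2 ≤ R ^ 2 + 2 * t ^ 2 := by
  -- Bounded convex functions are constant, so `dist (σ a) (c (a + v))` depends on `v` only. The
  -- lower bound follows; the upper one is the four point inequality for `σ 0`, `σ t`, `c t`, `c 0`.
  have hconst : ∀ v a b, dist (σ a) (c (a + v)) = dist (σ b) (c (b + v)) := fun v =>
    eq_of_convexOn_of_le (convexOn_dist_line_line hσ (τ := fun a => c (a + v))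
      (hc.comp (IsometryEquiv.addRight v).isometry)) (C := C + |v|) fun a => by
        have := dist_triangle (σ a) (c a) (c (a + v))
        rw [dist_line hc, sub_add_cancel_left, abs_neg] at this
        linarith [hC a]
  have h1 := hconst (-t) t 0
  have h2 := hconst 0 t 0
  simp only [add_neg_cancel, zero_add, add_zero] at h1 h2
  have h3 := dist_sq_add_dist_sq_le (σ 0) (σ t) (c t) (c 0)
  rw [h2, dist_line hσ, dist_line hc, dist_comm (c 0), h0, sq_abs, sq_abs] at h3
  have h4 := pow_le_pow_left₀ (h0 ▸ dist_nonneg) (hR t) 2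
  exact ⟨h1 ▸ hR _, by linarith⟩

variable [ProperSpace X]

/-- Segments at bounded distance from `σ 0` whose endpoints have projections going to the two ends
of a rank one axis converge to a line parallel to the axis. -/
lemma exists_parallel_of_tendsto {σ : ℝ → X} (hσ : Isometry σ) {h : X ≃ᵢ X} {l : ℝ} (hl : 0 < l)
    (hh : ∀ t, h (σ t) = σ (t + l)) (hr : ¬ BoundsFlatHalfPlane σ) {ι : Type*} (u : Ultrafilter ι)
    {y z : ι → X} {s t : ι → ℝ} (hy : ∀ i, IsProj σ (y i) (s i)) (hz : ∀ i, IsProj σ (z i) (t i))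
    (hs : Tendsto s u atBot) (ht : Tendsto t u atTop) {R : ℝ} {a : ι → ℝ}
    (ha : ∀ i, a i ∈ Set.Icc (0 : ℝ) 1) (hR : ∀ i, dist (σ 0) (seg (y i) (z i) (a i)) = R)
    (hR' : ∀ i, ∀ b ∈ Set.Icc (0 : ℝ) 1, R ≤ dist (σ 0) (seg (y i) (z i) b)) :
    ∃ c : ℝ → X, Isometry c ∧ (∀ t, dist (σ t) (c t) ≤ 2 * R) ∧ dist (σ 0) (c 0) = R ∧
      ∀ t, R ≤ dist (σ 0) (c t) := by
  set d := fun i => dist (y i) (z i) with hd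
  have hyfar := tendsto_dist_of_isProj_atBot hσ hy hs
  have hzfar : Tendsto (fun i => dist (σ 0) (z i)) u atTop := by
    have := tendsto_dist_of_isProj_atBot (isometry_reverse hσ) (fun i => (hz i).reverse)
      (tendsto_neg_atTop_atBot.comp ht)
    simpa using this
  have hyg := fun {b : ℝ} (hb : 0 ≤ b) => tendsto_geo_of_isProj_atBot hσ hl hh hr hy hs hb
  have hzg := fun {b : ℝ} (hb : 0 ≤ b) => tendsto_geo_of_isProj_atTop hσ hl hh hr hz ht hb
  set m := fun i => seg (y i) (z i) (a i) with hm
  have hmy : ∀ i, dist (m i) (y i) = a i * d i := fun i => by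
    rw [dist_comm, dist_left_seg _ _ (ha i).1 (ha i).2]
  have hmz : ∀ i, dist (m i) (z i) = (1 - a i) * d i := fun i =>
    dist_seg_right _ _ (ha i).1 (ha i).2
  have hfar : ∀ b, ∀ᶠ i in u, b ≤ a i * d i ∧ b ≤ (1 - a i) * d i ∧ b ≤ dist (σ 0) (y i) ∧
      b ≤ dist (σ 0) (z i) ∧ 0 < d i := by
    intro b
    filter_upwards [hyfar.eventually_ge_atTop (|b| + 1 + R), hzfar.eventually_ge_atTop (|b| + 1 + R)]
      with i h1 h2
    have e1 := dist_triangle (σ 0) (m i) (y i)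
    have e2 := dist_triangle (σ 0) (m i) (z i)
    rw [hmy, hR] at e1
    rw [hmz, hR] at e2
    have hR0 : 0 ≤ R := hR i ▸ dist_nonneg
    have hb := le_abs_self b
    have hb' := abs_nonneg b
    refine ⟨by linarith, by linarith, by linarith, by linarith, by nlinarith⟩
  -- The segment from `y i` to `z i`, parametrized by arc length with `m i` at time `0`.
  set C : ι → ℝ → X := fun i b => seg (y i) (z i) (a i + b / d i) with hC
  have hmem : ∀ b, ∀ᶠ i in u, a i + b / d i ∈ Set.Icc (0 : ℝ) 1 := by
    intro b
    filter_upwards [hfar |b|] with i ⟨h1, h2, _, _, h0⟩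
    have e : a i + b / d i = (a i * d i + b) / d i := by field_simp
    rw [e]
    refine ⟨div_nonneg ?_ h0.le, (div_le_one h0).2 ?_⟩
    · linarith [neg_abs_le b]
    · linarith [le_abs_self b]
  have hCdist : ∀ b b', ∀ᶠ i in u, dist (C i b) (C i b') = |b - b'| := by
    intro b b'
    filter_upwards [hmem b, hmem b', hfar 0] with i h1 h2 ⟨_, _, _, _, h0⟩
    simp only [hC]
    rw [dist_seg_seg_param _ _ h1.1 h1.2 h2.1 h2.2, add_sub_add_left_eq_sub, ← sub_div, abs_div,
      abs_of_pos h0]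
    exact div_mul_cancel₀ _ h0.ne'
  have hC0 : ∀ i, C i 0 = m i := fun i => by simp [hC, hm]
  have hlim : ∀ b, ∃ p, Tendsto (fun i => C i b) u (𝓝 p) := fun b =>
    exists_tendsto_of_bounded u _ (σ 0) (R + |b|) (by
      filter_upwards [hCdist 0 b] with i hi
      have := dist_triangle (σ 0) (C i 0) (C i b)
      rw [hi, hC0, hR, zero_sub, abs_neg] at this
      exact this)
  choose c hc using hlim
  refine ⟨c, Isometry.of_dist_eq fun b b' => ?_, fun b => ?_, ?_, fun b => ?_⟩
  · exact tendsto_nhds_unique ((hc b).dist (hc b'))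
      (tendsto_const_nhds.congr' ((hCdist b b').mono fun i hi => hi.symm))
  -- `σ b` and `c b` are limits of points at equal distance from `σ 0` and `m i` on segments with a
  -- common endpoint; moving the base point by `R` costs at most `2 * R`.
  · rcases le_total 0 b with hb | hb
    · refine le_of_tendsto ((hzg hb).dist (hc b)) ?_
      filter_upwards [hfar b, hmem b, hCdist 0 b] with i ⟨_, h1, _, h2, h0⟩ h3 h4
      have e : C i b = geo (m i) (z i) b := by
        refine eq_geo hb (by rwa [hmz]) ?_ ?_
        · rw [← hC0, h4, zero_sub, abs_neg, abs_of_nonneg hb]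
        · rw [dist_comm, dist_seg_right _ _ h3.1 h3.2, hmz, ← sub_sub, sub_mul (1 - a i)]
          rw [div_mul_cancel₀ _ h0.ne']
      rw [e, ← hR i]
      exact dist_geo_base_le hb h2 (by rwa [hmz])
    · have hb' : 0 ≤ -b := by linarith
      have := hyg hb'
      rw [neg_neg] at this
      refine le_of_tendsto (this.dist (hc b)) ?_
      filter_upwards [hfar (-b), hmem b, hCdist 0 b] with i ⟨h1, _, h2, _, h0⟩ h3 h4
      have e : C i b = geo (m i) (y i) (-b) := by
        refine eq_geo hb' (by rwa [hmy]) ?_ ?_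
        · rw [← hC0, h4, zero_sub, abs_neg, abs_of_nonpos hb]
        · rw [dist_left_seg _ _ h3.1 h3.2, hmy, add_mul]
          rw [div_mul_cancel₀ _ h0.ne', sub_neg_eq_add]
      rw [e, ← hR i]
      exact dist_geo_base_le hb' h2 (by rwa [hmy])
  · refine tendsto_nhds_unique (tendsto_const_nhds.dist (hc 0)) ?_
    simp only [hC0, hm, hR]
    exact tendsto_const_nhds
  · refine ge_of_tendsto (tendsto_const_nhds.dist (hc b)) ?_
    filter_upwards [hmem b] with i hi using hR' i _ hi

/-- Segments between points with distant projections to a rank one axis pass near the axis. -/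
lemma exists_dist_seg_le {σ : ℝ → X} (hσ : Isometry σ) {h : X ≃ᵢ X} {l : ℝ} (hl : 0 < l)
    (hh : ∀ t, h (σ t) = σ (t + l)) (hr : ¬ BoundsFlatHalfPlane σ) :
    ∃ D : ℝ, 0 < D ∧ ∀ y z s t, IsProj σ y s → IsProj σ z t → s ≤ -D → D ≤ t →
      ∃ a ∈ Set.Icc (0 : ℝ) 1, dist (σ 0) (seg y z a) ≤ D := by
  by_contra! hcon
  refine hr ?_
  -- If the claim fails, there is a parallel line at every distance `R`. The distance from its point
  -- `q` to `σ t` exceeds `R` by at most `t ^ 2 / R`, so the limiting slope is `c = 0`.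
  have key : ∀ R : ℕ, ∃ q : X, dist (σ 0) q = R ∧
      ∀ t, (R : ℝ) ≤ dist (σ t) q ∧ dist (σ t) q ^ 2 ≤ (R : ℝ) ^ 2 + 2 * t ^ 2 := by
    intro R
    choose y z s t hy hz hs ht hd using fun n : ℕ => hcon (R + n + 1) (by positivity)
    choose y' z' hy' hz' a ha hR hR' using fun n : ℕ => exists_seg_dist_eq hσ (hy n) (hz n)
      ((hs n).trans (by linarith [Nat.cast_nonneg (α := ℝ) R, Nat.cast_nonneg (α := ℝ) n]))
      ((by positivity : (0 : ℝ) ≤ R + n + 1).trans (ht n)) (Nat.cast_nonneg R)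
      (fun b hb => (by linarith [Nat.cast_nonneg (α := ℝ) n] : (R : ℝ) ≤ R + n + 1).trans
        (hd n b hb).le)
    have htop : Tendsto (fun n : ℕ => (R : ℝ) + n + 1) atTop atTop :=
      tendsto_atTop_add_const_right _ _
        (tendsto_atTop_add_const_left _ _ tendsto_natCast_atTop_atTop)
    have hsl : Tendsto s atTop atBot :=
      tendsto_atBot_mono hs (tendsto_neg_atTop_atBot.comp htop)
    have htl : Tendsto t atTop atTop := tendsto_atTop_mono ht htop
    obtain ⟨c, hc, hC, h0, hmin⟩ := exists_parallel_of_tendsto hσ hl hh hr (Ultrafilter.of atTop)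
      hy' hz' (hsl.mono_left (Ultrafilter.of_le _)) (htl.mono_left (Ultrafilter.of_le _)) ha hR hR'
    exact ⟨c 0, h0, dist_parallel hσ hc hC h0 hmin⟩
  choose q hq0 hq using key
  refine boundsFlatHalfPlane_of_tendsto hσ (F := atTop) q (c := 0) (by simp) ?_ fun t => ?_
  · simp only [hq0]
    exact tendsto_natCast_atTop_atTop
  · rw [zero_mul]
    refine squeeze_zero' (Eventually.of_forall fun R => ?_) ?_
      ((tendsto_const_nhds (x := t ^ 2)).div_atTop (tendsto_natCast_atTop_atTop (R := ℝ)))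
    · rw [hq0]; exact sub_nonneg.2 (hq R t).1
    · filter_upwards [eventually_gt_atTop 0] with R hR
      have hR0 : (0 : ℝ) < R := Nat.cast_pos.2 hR
      rw [hq0, sub_le_iff_le_add']
      refine abs_le_of_sq_le_sq ((hq R t).2.trans ?_) (by positivity) |>.trans' (le_abs_self _)
      have : ((R : ℝ) + t ^ 2 / R) ^ 2 = R ^ 2 + 2 * t ^ 2 + (t ^ 2 / R) ^ 2 := by
        field_simp
        ring
      rw [this]
      linarith [sq_nonneg (t ^ 2 / (R : ℝ))]

end Contracting

/-! ### Dynamics of rank one isometries -/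

section Dynamics

variable {X : Type*} [MetricSpace X]

/-- `σ` is a rank one axis of `h`, translated by `l`. -/
structure IsRankOneAxis (h : X ≃ᵢ X) (σ : ℝ → X) (l : ℝ) : Prop where
  isometry : Isometry σ
  pos : 0 < l
  translate : ∀ t, h (σ t) = σ (t + l)
  rankOne : ¬ BoundsFlatHalfPlane σ

lemma IsRankOneIsometry.exists_axis {h : X ≃ᵢ X} (hh : IsRankOneIsometry h) :
    ∃ σ l, IsRankOneAxis h σ l := by
  obtain ⟨σ, ⟨hσ, l, hl, ht⟩, -, hr⟩ := hh
  exact ⟨σ, l, hσ, hl, ht, hr⟩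

lemma IsRankOneAxis.pow {h : X ≃ᵢ X} {σ : ℝ → X} {l : ℝ} (H : IsRankOneAxis h σ l) {n : ℕ}
    (hn : 0 < n) : IsRankOneAxis (h ^ n) σ (n * l) :=
  ⟨H.isometry, mul_pos (Nat.cast_pos.2 hn) H.pos, pow_translate H.translate n, H.rankOne⟩

/-- The positive half of a line, as a ray. -/
def posRay {σ : ℝ → X} (hσ : Isometry σ) : GeodesicRay X :=
  ⟨fun t => σ t, Isometry.of_dist_eq fun s t => by
    rw [hσ.dist_eq, NNReal.dist_eq, Real.dist_eq]⟩

/-- The negative half of a line, as a ray. -/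
def negRay {σ : ℝ → X} (hσ : Isometry σ) : GeodesicRay X := posRay (isometry_reverse hσ)

lemma IsProj.of_pow {σ : ℝ → X} {h : X ≃ᵢ X} {l : ℝ} (hh : ∀ t, h (σ t) = σ (t + l)) {n : ℕ}
    {y : X} {s : ℝ} (hy : IsProj σ ((h ^ n) y) s) : IsProj σ y (s - n * l) := by
  have := hy.map (h := (h ^ n)⁻¹) (l := -(n * l))
    fun t => by rw [inv_translate (pow_translate hh n), sub_eq_add_neg]
  rwa [← IsometryEquiv.mul_apply, inv_mul_cancel, ← sub_eq_add_neg] at this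

lemma IndependentIsometries.inv_left {g h : X ≃ᵢ X} (H : IndependentIsometries g h) :
    IndependentIsometries g⁻¹ h := by
  intro x
  have := (H x).comp ((Homeomorph.neg ℤ).prodCongr (Homeomorph.refl ℤ)).isProperMap
  convert this using 1
  funext p
  simp [Function.comp]

lemma IndependentIsometries.symm {g h : X ≃ᵢ X} (H : IndependentIsometries g h) :
    IndependentIsometries h g := by
  intro x
  convert (H x).comp (Homeomorph.prodComm ℤ ℤ).isProperMap using 1
  funext p
  exact nndist_comm _ _

/-- Axes of independent isometries are not asymptotic. -/
lemma IndependentIsometries.not_asymptotic {g h : X ≃ᵢ X} (H : IndependentIsometries g h)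
    {σ τ : ℝ → X} {l l' : ℝ} (hg : IsRankOneAxis g σ l) (hh : IsRankOneAxis h τ l') :
    ¬ Asymptotic (posRay hg.isometry) (posRay hh.isometry) := by
  rintro ⟨C, hC⟩
  set K := l + C + dist (σ 0) (τ 0) with hK
  have hcpt := (H (σ 0)).isCompact_preimage (K := Set.Icc 0 K.toNNReal) isCompact_Icc
  have hfin := hcpt.finite_of_discrete
  -- With this exponent `g ^ m n` moves `σ 0` to within `l` of `σ (n * l')`. Asymptotic axes would
  -- thus give infinitely many pairs of powers with bounded distance.
  set m : ℕ → ℕ := fun n => ⌊n * l' / l⌋₊ with hm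
  have hinj : Function.Injective fun n : ℕ => ((m n : ℤ), (n : ℤ)) := fun a b hab => by
    simpa using (Prod.ext_iff.1 hab).2
  refine Set.infinite_range_of_injective hinj (hfin.subset ?_)
  rintro _ ⟨n, rfl⟩
  refine ⟨zero_le, ?_⟩
  rw [← NNReal.coe_le_coe, coe_nndist]
  refine le_trans ?_ (Real.le_coe_toNNReal K)
  simp only [zpow_natCast]
  have hpos := hg.pos
  have hpos' := hh.pos
  have h0 : 0 ≤ (n : ℝ) * l' := by positivity
  have h1 : dist ((g ^ m n) (σ 0)) (σ (n * l')) ≤ l := by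
    rw [pow_translate hg.translate, dist_line hg.isometry, zero_add]
    have a := Nat.floor_le (show 0 ≤ n * l' / l by positivity)
    have b := Nat.lt_floor_add_one (n * l' / l)
    rw [le_div_iff₀ hpos] at a
    rw [div_lt_iff₀ hpos] at b
    rw [abs_le]
    constructor <;> simp only [hm] <;> linarith
  have h2 : dist (σ (n * l')) (τ (n * l')) ≤ C := by
    have := hC (n * l').toNNReal
    simpa [posRay, Real.coe_toNNReal _ h0] using this
  have h3 : dist (τ (n * l')) ((h ^ n) (σ 0)) = dist (σ 0) (τ 0) := by
    rw [← zero_add ((n : ℝ) * l'), ← pow_translate hh.translate, (h ^ n).dist_eq, dist_comm]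
  linarith [dist_triangle4 ((g ^ m n) (σ 0)) (σ (n * l')) (τ (n * l')) ((h ^ n) (σ 0))]

variable [CNSpace X]

lemma IsRankOneAxis.reverse {h : X ≃ᵢ X} {σ : ℝ → X} {l : ℝ} (H : IsRankOneAxis h σ l) :
    IsRankOneAxis h⁻¹ (fun t => σ (-t)) l :=
  ⟨isometry_reverse H.isometry, H.pos,
    fun t => by rw [inv_translate H.translate]; congr 1; ring, fun h' => H.rankOne h'.reverse⟩

/-- The ends of axes of independent rank one isometries are distinct. -/
lemma IndependentIsometries.endpoint_ne {g h : X ≃ᵢ X} (H : IndependentIsometries g h)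
    {σ τ : ℝ → X} {l l' : ℝ} (hg : IsRankOneAxis g σ l) (hh : IsRankOneAxis h τ l') :
    ((posRay hg.isometry).endpoint ≠ (posRay hh.isometry).endpoint ∧
      (negRay hg.isometry).endpoint ≠ (posRay hh.isometry).endpoint) ∧
    (posRay hg.isometry).endpoint ≠ (negRay hh.isometry).endpoint ∧
      (negRay hg.isometry).endpoint ≠ (negRay hh.isometry).endpoint :=
  ⟨⟨fun e => H.not_asymptotic hg hh (GeodesicRay.endpoint_eq_iff.1 e),
    fun e => H.inv_left.not_asymptotic hg.reverse hh (GeodesicRay.endpoint_eq_iff.1 e)⟩,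
    fun e => H.symm.inv_left.symm.not_asymptotic hg hh.reverse (GeodesicRay.endpoint_eq_iff.1 e),
    fun e => H.inv_left.symm.inv_left.symm.not_asymptotic hg.reverse hh.reverse
      (GeodesicRay.endpoint_eq_iff.1 e)⟩

variable [ProperSpace X]

lemma IsRankOneAxis.asymptotic_of_isProj {h : X ≃ᵢ X} {σ : ℝ → X} {l : ℝ}
    (H : IsRankOneAxis h σ l) {ι : Type*} {F : Filter ι} [F.NeBot] {y : ι → X} {s : ι → ℝ}
    (hs : ∀ i, IsProj σ (y i) (s i)) (hlim : Tendsto s F atTop) {ρ : GeodesicRay X}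
    (hy : Tendsto (fun i => dist (ρ.1 0) (y i)) F atTop)
    (hρ : ∀ t : ℝ≥0, Tendsto (fun i => geo (ρ.1 0) (y i) t) F (𝓝 (ρ.1 t))) :
    Asymptotic ρ (posRay H.isometry) :=
  ⟨_, asymptotic_of_tendsto hy hρ fun t => by
    simpa [posRay] using tendsto_geo_of_isProj_atTop H.isometry H.pos H.translate H.rankOne hs hlim
      t.coe_nonneg⟩

/-- Along an ultrafilter, projections that are not eventually bounded above tend to `+∞`, and then
the points converge to the positive end. -/
lemma IsRankOneAxis.eventually_proj_le {h : X ≃ᵢ X} {σ : ℝ → X} {l : ℝ}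
    (H : IsRankOneAxis h σ l) {ι : Type*} {u : Ultrafilter ι} {y : ι → X} {s : ι → ℝ}
    (hs : ∀ i, IsProj σ (y i) (s i)) {ρ : GeodesicRay X}
    (hy : Tendsto (fun i => dist (ρ.1 0) (y i)) u atTop)
    (hρ : ∀ t : ℝ≥0, Tendsto (fun i => geo (ρ.1 0) (y i) t) u (𝓝 (ρ.1 t)))
    (hne : ρ.endpoint ≠ (posRay H.isometry).endpoint) : ∃ S, ∀ᶠ i in u, s i ≤ S := by
  by_contra! hcon
  refine hne (GeodesicRay.endpoint_eq_iff.2 (H.asymptotic_of_isProj hs ?_ hy hρ))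
  rw [tendsto_atTop]
  intro b
  have := hcon b
  exact this.mono fun i hi => (le_of_lt hi)

/-- The projections of the points of a ray which does not end at the negative end of a rank one
axis are bounded below. -/
lemma IsRankOneAxis.exists_le_proj {h : X ≃ᵢ X} {σ : ℝ → X} {l : ℝ}
    (H : IsRankOneAxis h σ l) {ρ : GeodesicRay X}
    (hne : ρ.endpoint ≠ (negRay H.isometry).endpoint) :
    ∃ S, ∀ᶠ T in atTop, ∀ s, IsProj σ (ρ.1 T) s → S ≤ s := by
  by_contra! hcon
  have hseq : ∀ n : ℕ, ∃ (T : ℝ≥0) (s : ℝ), n ≤ T ∧ IsProj σ (ρ.1 T) s ∧ s < -n := fun n => by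
    obtain ⟨T, ⟨s, hs, hlt⟩, hT⟩ :=
      ((hcon (-n)).and_eventually (eventually_ge_atTop (n : ℝ≥0))).exists
    exact ⟨T, s, hT, hs, hlt⟩
  choose T s hT hs hlt using hseq
  have hT' : Tendsto T atTop atTop := tendsto_atTop_mono hT tendsto_natCast_atTop_atTop
  refine hne (GeodesicRay.endpoint_eq_iff.2 (H.reverse.asymptotic_of_isProj
    (fun n => (hs n).reverse) ?_ (ρ.tendsto_dist_atTop.comp hT')
    (fun t => (ρ.tendsto_geo t).comp hT')))
  refine tendsto_atTop_mono (fun n => ?_) tendsto_natCast_atTop_atTop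
  linarith [hlt n]

/-- A rank one isometry fixes only the ends of its axis. -/
lemma IsRankOneAxis.eq_of_smul_eq {h : X ≃ᵢ X} {σ : ℝ → X} {l : ℝ}
    (H : IsRankOneAxis h σ l) {ξ : Boundary X} (hξ : h • ξ = ξ) :
    ξ = (posRay H.isometry).endpoint ∨ ξ = (negRay H.isometry).endpoint := by
  obtain ⟨ρ, rfl⟩ := exists_ray_endpoint ξ
  by_cases hne : ρ.endpoint = (negRay H.isometry).endpoint
  · exact Or.inr hne
  refine Or.inl (GeodesicRay.endpoint_eq_iff.2 ?_)
  obtain ⟨S, hS⟩ := H.exists_le_proj hne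
  have hpow : ∀ n : ℕ, h ^ n • ρ.endpoint = ρ.endpoint := fun n => by
    induction n with
    | zero => simp
    | succ n ih => rw [pow_succ, mul_smul, hξ, ih]
  have hasym : ∀ n : ℕ, ∃ C, ∀ t : ℝ≥0, dist ((h ^ n) (ρ.1 t)) (ρ.1 t) ≤ C := fun n => by
    have := hpow n
    rw [← map_endpoint] at this
    exact GeodesicRay.endpoint_eq_iff.1 this
  choose C hC using hasym
  choose s hs using fun p : ℕ × ℝ≥0 => exists_isProj H.isometry ((h ^ p.1) (ρ.1 p.2))
  have := curry_neBot (atTop : Filter ℕ) (atTop : Filter ℝ≥0)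
  -- For fixed `n` the points `h ^ n (ρ T)` stay at bounded distance from `ρ T`, so they converge to
  -- the end of `ρ` as `T` grows; their projections are eventually at least `S + n * l`. Taking `T`
  -- to infinity before `n` combines both.
  refine H.asymptotic_of_isProj (F := (atTop : Filter ℕ).curry (atTop : Filter ℝ≥0)) hs ?_ ?_ ?_
  · rw [tendsto_atTop]
    intro b
    rw [eventually_curry_iff]
    have hl : Tendsto (fun n : ℕ => S + n * l) atTop atTop :=
      tendsto_atTop_add_const_left _ _ (tendsto_natCast_atTop_atTop.atTop_mul_const H.pos)
    filter_upwards [hl.eventually_ge_atTop b] with n hn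
    filter_upwards [hS] with T hT
    linarith [hT _ (IsProj.of_pow H.translate (hs (n, T)))]
  · rw [tendsto_atTop]
    intro b
    rw [eventually_curry_iff]
    refine Eventually.of_forall fun n => ?_
    filter_upwards [ρ.tendsto_dist_atTop.eventually_ge_atTop (b + C n)] with T hT
    linarith [hC n T, dist_triangle (ρ.1 0) ((h ^ n) (ρ.1 T)) (ρ.1 T)]
  · intro t
    rw [Metric.tendsto_nhds]
    intro ε hε
    rw [eventually_curry_iff]
    refine Eventually.of_forall fun n => ?_
    exact Metric.tendsto_nhds.1 (tendsto_geo_of_dist_ray_le ρ tendsto_id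
      (Eventually.of_forall fun T => hC n T) t) ε hε

/-- At most one power of `g` maps `η` to a point `ξ` which is not an end of the axis of `g`. -/
lemma IsRankOneAxis.subsingleton_pow_smul_eq {g : X ≃ᵢ X} {σ : ℝ → X} {l : ℝ}
    (H : IsRankOneAxis g σ l) (η : Boundary X) {ξ : Boundary X}
    (h1 : (posRay H.isometry).endpoint ≠ ξ) (h2 : (negRay H.isometry).endpoint ≠ ξ) :
    {k : ℕ | g ^ k • η = ξ}.Subsingleton := by
  have key : ∀ a b : ℕ, a < b → g ^ a • η = ξ → g ^ b • η = ξ → False := by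
    intro a b hab ha hb
    obtain ⟨n, hn, rfl⟩ : ∃ n, 0 < n ∧ b = n + a := ⟨b - a, by omega, by omega⟩
    rw [pow_add, mul_smul, ha] at hb
    rcases (H.pow hn).eq_of_smul_eq hb with e | e
    · exact h1 e.symm
    · exact h2 e.symm
  intro a ha b hb
  rcases lt_trichotomy a b with h | h | h
  · exact (key a b h ha hb).elim
  · exact h
  · exact (key b a h hb ha).elim

/-- If `y i` converges to a point different from the positive end of the axis of `h` and `η` does
not end at the negative end, then the segments from `y i` to `h ^ N η` pass near a fixed point. -/
lemma IsRankOneAxis.exists_dist_seg_pow_le {h : X ≃ᵢ X} {σ : ℝ → X} {l : ℝ}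
    (H : IsRankOneAxis h σ l) (o : X) {ι : Type*} {u : Ultrafilter ι} {y : ι → X}
    {ρ : GeodesicRay X} (hy : Tendsto (fun i => dist (ρ.1 0) (y i)) u atTop)
    (hρ : ∀ t : ℝ≥0, Tendsto (fun i => geo (ρ.1 0) (y i) t) u (𝓝 (ρ.1 t)))
    (hne : ρ.endpoint ≠ (posRay H.isometry).endpoint) {η : GeodesicRay X}
    (hη : η.endpoint ≠ (negRay H.isometry).endpoint) :
    ∃ N₀ : ℕ, ∀ N ≥ N₀, ∃ C, ∀ᶠ i in u, ∀ᶠ T in atTop, ∃ a ∈ Set.Icc (0 : ℝ) 1,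
      dist o (seg (y i) ((h ^ N) (η.1 T)) a) ≤ C := by
  choose s hs using fun i => exists_isProj H.isometry (y i)
  obtain ⟨S, hS⟩ := H.eventually_proj_le hs hy hρ hne
  obtain ⟨S', hS'⟩ := H.exists_le_proj hη
  obtain ⟨D, hD0, hD⟩ := exists_dist_seg_le H.isometry H.pos H.translate H.rankOne
  have hl : Tendsto (fun n : ℕ => (n : ℝ) * l) atTop atTop :=
    tendsto_natCast_atTop_atTop.atTop_mul_const H.pos
  -- Translating back by `h ^ m` puts the projections of `y i` below `-D`; then `N` has to be so
  -- large that those of `h ^ N η`, translated in the same way, are above `D`.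
  obtain ⟨m, hm⟩ := (hl.eventually_ge_atTop (S + D)).exists
  obtain ⟨N₀, hN₀⟩ := eventually_atTop.1 (hl.eventually_ge_atTop (m * l + D - S'))
  refine ⟨N₀, fun N hN => ⟨dist o ((h ^ m) (σ 0)) + D, ?_⟩⟩
  filter_upwards [hS] with i hi
  filter_upwards [hS'] with T hT
  set y' := (h ^ m)⁻¹ (y i)
  set z' := (h ^ m)⁻¹ ((h ^ N) (η.1 T))
  have hy' : (h ^ m) y' = y i := (h ^ m).apply_symm_apply _
  have hz' : (h ^ m) z' = (h ^ N) (η.1 T) := (h ^ m).apply_symm_apply _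
  obtain ⟨t, ht⟩ := exists_isProj H.isometry ((h ^ N) (η.1 T))
  have h1 := hT _ (IsProj.of_pow H.translate ht)
  have h2 := hN₀ N hN
  obtain ⟨a, ha, hle⟩ := hD y' z' _ _ (IsProj.of_pow H.translate (hy'.symm ▸ hs i))
    (IsProj.of_pow H.translate (hz'.symm ▸ ht)) (by linarith) (by linarith)
  refine ⟨a, ha, ?_⟩
  rw [← hy', ← hz', ← map_seg _ _ _ ha.1 ha.2]
  have := dist_triangle o ((h ^ m) (σ 0)) ((h ^ m) (seg y' z' a))
  rw [(h ^ m).dist_eq] at this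
  linarith

omit [ProperSpace X] in
/-- If `γ i o` converges to `ρ` and the segments from `(γ i)⁻¹ o` to `υ` pass near `o` then
`γ i υ` converges to `ρ`. -/
lemma tendsto_ray_of_dist_seg_le {ι : Type*} {F : Filter ι} {γ : ι → X ≃ᵢ X}
    {ρ υ : GeodesicRay X} (hγ : Tendsto (fun i => dist (ρ.1 0) (γ i (ρ.1 0))) F atTop)
    (hρ : ∀ t : ℝ≥0, Tendsto (fun i => geo (ρ.1 0) (γ i (ρ.1 0)) t) F (𝓝 (ρ.1 t))) {C : ℝ}
    (hC : ∀ᶠ i in F, ∀ᶠ T in atTop, ∃ a ∈ Set.Icc (0 : ℝ) 1,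
      dist (ρ.1 0) (seg ((γ i)⁻¹ (ρ.1 0)) (υ.1 T) a) ≤ C) {r : ι → GeodesicRay X}
    (hr0 : ∀ i, (r i).1 0 = ρ.1 0) (hr : ∀ i, Asymptotic (υ.map (γ i)) (r i)) (t : ℝ≥0) :
    Tendsto (fun i => (r i).1 t) F (𝓝 (ρ.1 t)) := by
  set o := ρ.1 0
  have hle : ∀ᶠ i in F, dist (geo o (γ i o) t) ((r i).1 t) ≤
      t / (dist o (γ i o) - C) * (2 * C) := by
    filter_upwards [hC, hγ.eventually_gt_atTop (t + C)] with i hi hfar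
    have hlim : Tendsto (fun T : ℝ≥0 => geo o (γ i (υ.1 T)) t) atTop (𝓝 ((r i).1 t)) := by
      obtain ⟨B, hB⟩ := hr i
      have := tendsto_geo_of_dist_ray_le (r i) (F := atTop) (T := id)
        (z := fun T : ℝ≥0 => γ i (υ.1 T)) tendsto_id (Eventually.of_forall hB) t
      rwa [hr0] at this
    refine le_of_tendsto (tendsto_const_nhds.dist hlim) ?_
    filter_upwards [hi] with T hT
    obtain ⟨a, ha, hd⟩ := hT
    -- The image under `γ i` of the point near `o`: it lies on the segment from `o` to `γ i (υ T)`
    -- within `C` of `γ i o`, so this segment and the one to `γ i o` agree closely at time `t`.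
    set w := seg o (γ i (υ.1 T)) a with hw
    have hwd : dist (γ i o) w ≤ C := by
      rw [← (γ i).dist_eq, map_seg _ _ _ ha.1 ha.2] at hd
      have e : γ i ((γ i)⁻¹ o) = o := (γ i).apply_symm_apply _
      rwa [e] at hd
    have how : dist o (γ i o) - C ≤ dist o w := by
      linarith [dist_triangle_right o (γ i o) w]
    have hC0 : 0 ≤ C := dist_nonneg.trans hd
    have hwle : dist o w ≤ dist o (γ i (υ.1 T)) := by
      rw [hw, dist_left_seg _ _ ha.1 ha.2]
      exact mul_le_of_le_one_left dist_nonneg ha.2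
    have hwg : w = geo o (γ i (υ.1 T)) (dist o w) := by
      refine eq_geo dist_nonneg hwle le_rfl ?_
      rw [dist_comm, hw, dist_seg_right _ _ ha.1 ha.2, dist_left_seg _ _ ha.1 ha.2]
      linarith
    have hgeo : geo o w t = geo o (γ i (υ.1 T)) t := by
      conv_lhs => rw [hwg]
      exact geo_geo t.coe_nonneg (by linarith) hwle
    rw [← hgeo]
    refine (dist_geo_geo_same_le t.coe_nonneg (T := dist o (γ i o) - C) (by linarith)
      (by linarith) how).trans ?_
    have : 0 ≤ dist o (γ i o) - C := by linarith [t.coe_nonneg]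
    gcongr
  rw [tendsto_iff_dist_tendsto_zero]
  have h1 := tendsto_iff_dist_tendsto_zero.1 (hρ t)
  have h2 : Tendsto (fun i => (t : ℝ) / (dist o (γ i o) - C) * (2 * C)) F (𝓝 (0 * (2 * C))) :=
    (tendsto_const_nhds.div_atTop (tendsto_atTop_add_const_right _ (-C) hγ)).mul_const _
  have h3 := h2.add h1
  rw [zero_mul, add_zero] at h3
  refine squeeze_zero' (Eventually.of_forall fun _ => dist_nonneg) ?_ h3
  filter_upwards [hle] with i hi
  have := dist_triangle_left ((r i).1 t) (ρ.1 t) (geo o (γ i o) t)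
  linarith

end Dynamics

/-! ### Segments in products -/

section Vary

variable {X : Type*} [MetricSpace X] [CNSpace X]

lemma tendsto_geo_of_tendsto {ι : Type*} {F : Filter ι} {o p : X} {z : ι → X}
    (hz : Tendsto (fun i => dist o (z i)) F atTop) {t : ℝ} {s : ι → ℝ}
    (h : Tendsto (fun i => geo o (z i) t) F (𝓝 p)) (ht : 0 ≤ t) (hs0 : ∀ i, 0 ≤ s i)
    (hs : Tendsto s F (𝓝 t)) : Tendsto (fun i => geo o (z i) (s i)) F (𝓝 p) := by
  refine h.congr_dist ?_
  refine squeeze_zero' (Eventually.of_forall fun _ => dist_nonneg) ?_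
    (tendsto_iff_dist_tendsto_zero.1 hs)
  filter_upwards [hz.eventually_ge_atTop (t + 1),
    hs.eventually_le_const (lt_add_one t)] with i h1 h2
  rw [(isGeodesicPath_geo o (z i)).2.2.2 t ⟨ht, by linarith⟩ (s i) ⟨hs0 i, h2.trans h1⟩,
    dist_comm, Real.dist_eq]

lemma tendsto_geo_of_dist_le {ι : Type*} {F : Filter ι} {o p : X} {z z' : ι → X}
    (hz : Tendsto (fun i => dist o (z i)) F atTop) {C : ℝ} (hC : ∀ i, dist (z i) (z' i) ≤ C)
    {t : ℝ} (ht : 0 ≤ t) (h : Tendsto (fun i => geo o (z i) t) F (𝓝 p)) :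
    Tendsto (fun i => dist o (z' i)) F atTop ∧ Tendsto (fun i => geo o (z' i) t) F (𝓝 p) := by
  have hz' : Tendsto (fun i => dist o (z' i)) F atTop := by
    refine tendsto_atTop_mono (fun i => ?_) (tendsto_atTop_add_const_right _ (-C) hz)
    linarith [dist_triangle_right o (z i) (z' i), hC i]
  refine ⟨hz', h.congr_dist ?_⟩
  have h0 : Tendsto (fun i => t / (dist o (z i) - C) * (2 * C)) F (𝓝 (0 * (2 * C))) :=
    (tendsto_const_nhds.div_atTop (tendsto_atTop_add_const_right _ (-C) hz)).mul_const _
  rw [zero_mul] at h0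
  refine squeeze_zero' (Eventually.of_forall fun _ => dist_nonneg) ?_ h0
  filter_upwards [hz.eventually_ge_atTop (t + C)] with i hi
  have hC0 : 0 ≤ C := dist_nonneg.trans (hC i)
  refine (dist_geo_geo_same_le ht (T := dist o (z i) - C) (by linarith) (by linarith)
    (by linarith [dist_triangle_right o (z i) (z' i), hC i])).trans ?_
  have : 0 ≤ dist o (z i) - C := by linarith
  have := hC i
  gcongr

end Vary

section Product

variable {r : ℕ} {X : Fin r → Type*} [∀ i, MetricSpace (X i)]

lemma piLp_dist_apply_le (x y : PiLp 2 X) (i : Fin r) : dist (x i) (y i) ≤ dist x y :=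
  PiLp.dist_apply_le (p := 2) x y i

variable [∀ i, CNSpace (X i)]

lemma seg_apply (x y : PiLp 2 X) {s : ℝ} (h0 : 0 ≤ s) (h1 : s ≤ 1) (i : Fin r) :
    seg x y s i = seg (x i) (y i) s := by
  have : WithLp.toLp 2 (fun i => seg (x i) (y i) s) = seg x y s := by
    refine eq_seg h0 h1 ?_ ?_
    · refine abs_le_of_sq_le_sq (le_of_eq ?_) (by positivity) |>.trans' (le_abs_self _)
      rw [mul_pow, piLp_dist_sq, piLp_dist_sq, Finset.mul_sum]
      refine Finset.sum_congr rfl fun i _ => ?_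
      rw [← mul_pow, ← dist_left_seg _ _ h0 h1]
    · refine abs_le_of_sq_le_sq (le_of_eq ?_) (mul_nonneg (sub_nonneg.2 h1) dist_nonneg)
        |>.trans' (le_abs_self _)
      rw [mul_pow, piLp_dist_sq, piLp_dist_sq, Finset.mul_sum]
      refine Finset.sum_congr rfl fun i _ => ?_
      rw [← mul_pow, ← dist_seg_right _ _ h0 h1, dist_comm]
  rw [← this]

lemma geo_apply {x y : PiLp 2 X} {t : ℝ} (h0 : 0 ≤ t) (h1 : t ≤ dist x y) (i : Fin r) :
    geo x y t i = geo (x i) (y i) (t * (dist (x i) (y i) / dist x y)) := by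
  have ht1 := div_dist_le_one h1
  have ht0 : 0 ≤ t / dist x y := by positivity
  rw [geo, seg_apply x y ht0 ht1]
  have e : t * (dist (x i) (y i) / dist x y) = t / dist x y * dist (x i) (y i) := by ring
  rw [e]
  refine eq_geo (by positivity) (mul_le_of_le_one_left dist_nonneg ht1)
    (dist_left_seg _ _ ht0 ht1).le ?_
  rw [dist_comm, dist_seg_right _ _ ht0 ht1]
  linarith

/-- The coordinates of points converging to the endpoint of a ray of positive slopes converge to
the endpoints of the coordinate rays. -/
lemma tendsto_coord {ι : Type*} {F : Filter ι} {σ : GeodesicRay (PiLp 2 X)} {θ : Fin r → ℝ≥0}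
    (hθ : θ ∈ regularSlopes r) (hσ : HasSlope σ θ) {z : ι → PiLp 2 X}
    (hz : Tendsto (fun n => dist (σ.1 0) (z n)) F atTop)
    (h : ∀ t : ℝ≥0, Tendsto (fun n => geo (σ.1 0) (z n) t) F (𝓝 (σ.1 t))) (i : Fin r) :
    Tendsto (fun n => dist (σ.1 0 i) (z n i)) F atTop ∧
      ∀ t : ℝ≥0, Tendsto (fun n => geo (σ.1 0 i) (z n i) t) F
        (𝓝 ((coordRay σ θ hθ hσ i).1 t)) := by
  have hpos : (0 : ℝ) < θ i := hθ.1 i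
  have happ : Continuous fun p : PiLp 2 X => p i :=
    (LipschitzWith.of_dist_le_mul (K := 1) fun x y => by
      simpa using piLp_dist_apply_le x y i).continuous
  -- The speed of the `i`-th coordinate along the segment to `z n`. It tends to `θ i`, as seen at
  -- time `1`.
  set q := fun n => dist (σ.1 0 i) (z n i) / dist (σ.1 0) (z n) with hq
  have hq0 : ∀ n, 0 ≤ q n := fun n => by positivity
  have hgeo : ∀ t : ℝ≥0, ∀ᶠ n in F, geo (σ.1 0) (z n) t i = geo (σ.1 0 i) (z n i) (t * q n) ∧
      t * q n ≤ dist (σ.1 0 i) (z n i) := by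
    intro t
    filter_upwards [hz.eventually_ge_atTop (t : ℝ), hz.eventually_gt_atTop 0] with n hn hn0
    refine ⟨geo_apply t.coe_nonneg hn i, ?_⟩
    rw [hq]
    change (t : ℝ) * (_ / _) ≤ _
    rw [mul_div_assoc', div_le_iff₀ hn0, mul_comm]
    gcongr
  have hqlim : Tendsto q F (𝓝 (θ i)) := by
    have h1 := tendsto_const_nhds (x := σ.1 0 i) |>.dist ((happ.tendsto _).comp (h 1))
    rw [hσ i 0 1] at h1
    have e : (θ i : ℝ) * dist (0 : ℝ≥0) 1 = θ i := by simp [NNReal.dist_eq]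
    rw [e] at h1
    refine h1.congr' ?_
    filter_upwards [hgeo 1] with n ⟨hn, hn'⟩
    simp only [Function.comp, hn]
    rw [dist_left_geo (by simpa using hq0 n) hn']
    simp
  have hfar : Tendsto (fun n => dist (σ.1 0 i) (z n i)) F atTop := by
    refine (hqlim.pos_mul_atTop hpos hz).congr' ?_
    filter_upwards [hz.eventually_gt_atTop 0] with n hn
    exact div_mul_cancel₀ _ hn.ne'
  refine ⟨hfar, fun t => ?_⟩
  have h1 := (happ.tendsto _).comp (h (t / θ i))
  have h2 : Tendsto (fun n => geo (σ.1 0 i) (z n i) ((t / θ i : ℝ≥0) * q n)) F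
      (𝓝 ((coordRay σ θ hθ hσ i).1 t)) := by
    refine Tendsto.congr' ?_ h1
    filter_upwards [hgeo (t / θ i)] with n hn using hn.1
  have hs : Tendsto (fun n => ((t / θ i : ℝ≥0) : ℝ) * q n) F (𝓝 t) := by
    have := hqlim.const_mul ((t / θ i : ℝ≥0) : ℝ)
    rwa [NNReal.coe_div, div_mul_cancel₀ _ hpos.ne'] at this
  refine h2.congr_dist ?_
  refine squeeze_zero' (Eventually.of_forall fun _ => dist_nonneg) ?_
    (tendsto_iff_dist_tendsto_zero.1 hs)
  filter_upwards [hgeo (t / θ i), hfar.eventually_ge_atTop (t : ℝ)] with n ⟨_, h1⟩ h2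
  rw [(isGeodesicPath_geo _ _).2.2.2 _ ⟨mul_nonneg (NNReal.coe_nonneg _) (hq0 n), h1⟩ _
    ⟨t.coe_nonneg, h2⟩, Real.dist_eq]

/-- The ray of the product with the given coordinate rays and slopes. -/
noncomputable def productRay (ρ : ∀ i, GeodesicRay (X i)) (θ : Fin r → ℝ≥0)
    (hθ : θ ∈ regularSlopes r) : GeodesicRay (PiLp 2 X) :=
  ⟨fun t => WithLp.toLp 2 fun i => (ρ i).1 (θ i * t), Isometry.of_dist_eq fun s t => by
    refine (pow_left_inj₀ dist_nonneg dist_nonneg two_ne_zero).1 ?_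
    rw [piLp_dist_sq]
    have h : ∀ i, dist ((ρ i).1 (θ i * s)) ((ρ i).1 (θ i * t)) ^ 2 =
        (θ i : ℝ) ^ 2 * dist s t ^ 2 := fun i => by
      rw [(ρ i).dist_eq, NNReal.dist_eq, sq_abs, sq_abs]
      push_cast
      ring
    have h1 : ∑ i, (θ i : ℝ) ^ 2 = 1 := by exact_mod_cast hθ.2
    simp only [h]
    rw [← Finset.sum_mul, h1, one_mul]⟩

omit [∀ i, CNSpace (X i)] in
lemma hasSlope_productRay (ρ : ∀ i, GeodesicRay (X i)) (θ : Fin r → ℝ≥0)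
    (hθ : θ ∈ regularSlopes r) : HasSlope (productRay ρ θ hθ) θ := by
  intro i s t
  change dist ((ρ i).1 (θ i * s)) ((ρ i).1 (θ i * t)) = _
  rw [(ρ i).dist_eq, NNReal.dist_eq, NNReal.coe_mul, NNReal.coe_mul, ← mul_sub, abs_mul,
    abs_of_nonneg (θ i).coe_nonneg]

omit [∀ i, CNSpace (X i)] in
lemma furstenbergProj_productRay (ρ : ∀ i, GeodesicRay (X i)) (θ : Fin r → ℝ≥0)
    (hθ : θ ∈ regularSlopes r) :
    furstenbergProj ⟨(productRay ρ θ hθ).endpoint, _, θ, rfl, hθ, hasSlope_productRay ρ θ hθ⟩ =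
      fun i => (ρ i).endpoint := by
  funext i
  rw [furstenbergProj_endpoint _ θ hθ (hasSlope_productRay ρ θ hθ)]
  congr 1
  refine Subtype.ext (funext fun t => ?_)
  change (ρ i).1 (θ i * (t / θ i)) = _
  rw [mul_div_cancel₀ _ (hθ.1 i).ne']

omit [∀ i, CNSpace (X i)] in
lemma smul_piLp_apply (γ : ∀ i, X i ≃ᵢ X i) (x : PiLp 2 X) (i : Fin r) : (γ • x) i = γ i (x i) :=
  rfl

end Product

/-! ### The Furstenberg limit set -/

section Limit

variable {r : ℕ} {X : Fin r → Type*} [∀ i, MetricSpace (X i)] [∀ i, CNSpace (X i)]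

/-- The slope vector of a regular axial isometry with translation lengths `l`. -/
lemma exists_slope (hr : 1 ≤ r) {l : Fin r → ℝ} (hl : ∀ i, 0 < l i) :
    ∃ (θ : Fin r → ℝ≥0) (L : ℝ), θ ∈ regularSlopes r ∧ 0 < L ∧ L ^ 2 = ∑ i, l i ^ 2 ∧
      ∀ i, (θ i : ℝ) = l i / L := by
  have hS : 0 < ∑ i, l i ^ 2 := Finset.sum_pos (fun i _ => pow_pos (hl i) 2) ⟨⟨0, hr⟩, Finset.mem_univ _⟩
  set L := √(∑ i, l i ^ 2)
  have hL : 0 < L := Real.sqrt_pos.2 hS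
  have hL2 : L ^ 2 = ∑ i, l i ^ 2 := Real.sq_sqrt hS.le
  refine ⟨fun i => ⟨l i / L, (div_pos (hl i) hL).le⟩, L, ⟨fun i => div_pos (hl i) hL, ?_⟩, hL, hL2,
    fun i => rfl⟩
  refine NNReal.coe_injective ?_
  push_cast
  change ∑ i, (l i / L) ^ 2 = 1
  simp only [div_pow]
  rw [← Finset.sum_div, ← hL2, div_self (pow_pos hL 2).ne']

/-- Orbit points converge to the limits of the translates of the attracting point of a regular
axial isometry, along the slope of this isometry. -/
lemma tendsto_geo_of_axis {z : ℕ → PiLp 2 X} {x : PiLp 2 X} {l : Fin r → ℝ} (hl : ∀ i, 0 < l i)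
    {θ : Fin r → ℝ≥0} {L : ℝ} (hL : 0 < L) (hL2 : L ^ 2 = ∑ i, l i ^ 2)
    (hθ : ∀ i, (θ i : ℝ) = l i / L) {τ : ∀ i, GeodesicRay (X i)} (hτ : ∀ i, (τ i).1 0 = x i)
    {ρ : ∀ i, GeodesicRay (X i)} (hρ : ∀ i, Asymptotic (τ i) (ρ i)) {C : Fin r → ℝ}
    (hC : ∀ i, ∀ k : ℕ, dist (z k i) ((ρ i).1 (k * (l i).toNNReal)) ≤ C i) (R : ℝ≥0) :
    Tendsto (fun k => dist x (z k)) atTop atTop ∧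
      ∀ i, Tendsto (fun k => geo x (z k) R i) atTop (𝓝 ((τ i).1 (θ i * R))) := by
  -- Up to a bounded error `z k i` has distance `k * l i` from `x i`. So coordinate distances grow
  -- at rate `l i`, the total distance at rate `L`, and the quotient is the slope `θ i`.
  have hd : ∀ i, Tendsto (fun k : ℕ => dist (x i) (z k i) / k) atTop (𝓝 (l i)) := by
    intro i
    have h0 : Tendsto (fun k : ℕ => (C i + dist (x i) ((ρ i).1 0)) / (k : ℝ)) atTop (𝓝 0) :=
      tendsto_const_nhds.div_atTop tendsto_natCast_atTop_atTop
    rw [tendsto_iff_dist_tendsto_zero]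
    refine squeeze_zero' (Eventually.of_forall fun _ => dist_nonneg) ?_ h0
    filter_upwards [eventually_gt_atTop 0] with k hk
    have hk' : (0 : ℝ) < k := Nat.cast_pos.2 hk
    have h1 := (ρ i).dist_zero (k * (l i).toNNReal)
    push_cast at h1
    rw [Real.coe_toNNReal _ (hl i).le] at h1
    have h2 := hC i k
    have e : dist (x i) (z k i) / k - l i = (dist (x i) (z k i) - k * l i) / k := by field_simp
    rw [Real.dist_eq, e, abs_div, abs_of_pos hk']
    gcongr
    rw [abs_le]
    have t1 := dist_triangle4 (x i) ((ρ i).1 0) ((ρ i).1 (k * (l i).toNNReal)) (z k i)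
    have t2 := dist_triangle4 ((ρ i).1 0) (x i) (z k i) ((ρ i).1 (k * (l i).toNNReal))
    rw [dist_comm ((ρ i).1 (k * (l i).toNNReal)) (z k i)] at t1
    rw [dist_comm _ (x i)] at t2
    constructor <;> linarith
  have hD : Tendsto (fun k : ℕ => dist x (z k) / k) atTop (𝓝 L) := by
    have h1 : Tendsto (fun k : ℕ => √(∑ i, (dist (x i) (z k i) / k) ^ 2)) atTop
        (𝓝 (√(∑ i, l i ^ 2))) :=
      (tendsto_finsetSum _ fun i _ => (hd i).pow 2).sqrt
    rw [← hL2, Real.sqrt_sq hL.le] at h1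
    refine h1.congr fun k => ?_
    simp only [div_pow]
    rw [← Finset.sum_div, ← piLp_dist_sq, ← div_pow, Real.sqrt_sq (by positivity)]
  have hfar : Tendsto (fun k => dist x (z k)) atTop atTop := by
    refine (hD.pos_mul_atTop hL tendsto_natCast_atTop_atTop).congr' ?_
    filter_upwards [eventually_gt_atTop 0] with k hk
    exact div_mul_cancel₀ _ (Nat.cast_pos.2 hk).ne'
  refine ⟨hfar, fun i => ?_⟩
  have hq : Tendsto (fun k => dist (x i) (z k i) / dist x (z k)) atTop (𝓝 (θ i)) := by
    rw [hθ]
    refine ((hd i).div hD hL.ne').congr' ?_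
    filter_upwards [eventually_gt_atTop 0] with k hk
    exact div_div_div_cancel_right₀ (Nat.cast_pos.2 hk).ne' _ _
  have hfari : Tendsto (fun k => dist ((ρ i).1 0) (z k i)) atTop atTop := by
    refine tendsto_dist_of_tendsto_dist (o := x i) _ ?_
    refine ((hd i).pos_mul_atTop (hl i) tendsto_natCast_atTop_atTop).congr' ?_
    filter_upwards [eventually_gt_atTop 0] with k hk
    exact div_mul_cancel₀ _ (Nat.cast_pos.2 hk).ne'
  have hT : Tendsto (fun k : ℕ => (k : ℝ≥0) * (l i).toNNReal) atTop atTop :=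
    tendsto_natCast_atTop_atTop.atTop_mul_const (Real.toNNReal_pos.2 (hl i))
  have key := tendsto_geo_of_asymptotic (hρ i) hfari
    (tendsto_geo_of_dist_ray_le (ρ i) hT (Eventually.of_forall (hC i))) (θ i * R)
  rw [hτ i] at key
  have hs : Tendsto (fun k => (R : ℝ) * (dist (x i) (z k i) / dist x (z k))) atTop
      (𝓝 ((θ i * R : ℝ≥0) : ℝ)) := by
    rw [NNReal.coe_mul, mul_comm (θ i : ℝ)]
    exact hq.const_mul _
  refine (tendsto_geo_of_tendsto (tendsto_dist_of_tendsto_dist (x i) hfari) key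
    (NNReal.coe_nonneg _) (fun k => by positivity) hs).congr' ?_
  filter_upwards [hfar.eventually_ge_atTop (R : ℝ)] with k hk
  exact (geo_apply R.coe_nonneg hk i).symm

/-- The closure of the orbit of the attracting point of a regular axial isometry is contained in the
Furstenberg limit set. -/
lemma closure_orbit_subset [∀ i, ProperSpace (X i)] (hr : 1 ≤ r)
    (Γ : Subgroup (∀ i, X i ≃ᵢ X i)) (x : PiLp 2 X)
    {h : ∀ i, X i ≃ᵢ X i} (hΓ : h ∈ Γ) {σ : ∀ i, ℝ → X i} {l : Fin r → ℝ}
    (H : ∀ i, IsRankOneAxis (h i) (σ i) (l i)) :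
    closure {ξ | ∃ γ ∈ Γ, ξ = γ • fun i => (posRay (H i).isometry).endpoint} ⊆
      furstenbergLimitSet Γ x := by
  intro ξ hξ
  obtain ⟨θ, L, hθ, hL, hL2, hθl⟩ := exists_slope hr fun i => (H i).pos
  have hex : ∀ i, ∃ ρ : GeodesicRay (X i), ρ.endpoint = ξ i ∧ ρ.1 0 = x i := fun i => by
    obtain ⟨ρ', hρ'⟩ := exists_ray_endpoint (ξ i)
    obtain ⟨ρ, h0, hρ⟩ := exists_asymptotic_ray ρ' (x i)
    exact ⟨ρ, by rw [← hρ']; exact GeodesicRay.endpoint_eq_iff.2 (Asymptotic.symm ⟨_, hρ⟩), h0⟩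
  choose ρ hρ hρ0 using hex
  set σ' := productRay ρ θ hθ with hσ'
  have h0 : σ'.1 0 = x := by
    refine PiLp.ext fun i => ?_
    change (ρ i).1 (θ i * 0) = x i
    rw [mul_zero, hρ0]
  refine ⟨⟨σ'.endpoint, σ', θ, rfl, hθ, hasSlope_productRay ρ θ hθ⟩, ?_, ?_⟩
  swap
  · exact (furstenbergProj_productRay ρ θ hθ).trans (funext hρ)
  have step : ∀ n : ℕ, ∃ γ ∈ Γ, ((n : ℝ) + 1) < dist (σ'.1 0) (γ • x) ∧
      dist (geo (σ'.1 0) (γ • x) ((n : ℝ≥0) + 1 : ℝ≥0)) (σ'.1 (n + 1)) < 1 / ((n : ℝ) + 1) := by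
    intro n
    set R : ℝ≥0 := (n : ℝ≥0) + 1 with hR
    have hRpos : 0 < R := by positivity
    set ε : ℝ := 1 / ((n : ℝ) + 1) with hε
    have hε0 : 0 < ε := by positivity
    -- The tolerance `ε / (r + 1)` in each of the `r` coordinates keeps the sum of squares below `ε
    -- ^ 2`.
    obtain ⟨_, ⟨γ, hγ, rfl⟩, τ, hτ⟩ := exists_rays_of_mem_closure hξ ρ hρ (fun i => θ i * R)
      (fun i => mul_pos (hθ.1 i) hRpos) (ε := ε / (r + 1)) (by positivity)
    have hz := tendsto_geo_of_axis (x := x) (z := fun k : ℕ => (γ * h ^ k) • x) (fun i => (H i).pos)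
      hL hL2 hθl (τ := τ) (fun i => (hτ i).2.1.trans (hρ0 i))
      (ρ := fun i => (posRay (H i).isometry).map (γ i))
      (fun i => GeodesicRay.endpoint_eq_iff.1 (hτ i).1) (C := fun i => dist (x i) (σ i 0))
      (fun i k => by
        rw [smul_piLp_apply]
        change dist (γ i ((h i ^ k) (x i))) (γ i (σ i ((k * (l i).toNNReal : ℝ≥0) : ℝ))) ≤ _
        have e := pow_translate (H i).translate k 0
        rw [zero_add] at e
        rw [NNReal.coe_mul, NNReal.coe_natCast, Real.coe_toNNReal _ (H i).pos.le, ← e,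
          (γ i).dist_eq, (h i ^ k).dist_eq]) R
    have hsum : Tendsto (fun k : ℕ => dist (geo x ((γ * h ^ k) • x) R) (σ'.1 R) ^ 2) atTop
        (𝓝 (∑ i, dist ((τ i).1 (θ i * R)) ((ρ i).1 (θ i * R)) ^ 2)) := by
      simp only [piLp_dist_sq]
      exact tendsto_finsetSum _ fun i _ => ((hz.2 i).dist tendsto_const_nhds).pow 2
    have hlt : ∑ i, dist ((τ i).1 (θ i * R)) ((ρ i).1 (θ i * R)) ^ 2 < ε ^ 2 := by
      have h1 : ∑ i, dist ((τ i).1 (θ i * R)) ((ρ i).1 (θ i * R)) ^ 2 ≤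
          ∑ _i : Fin r, (ε / (r + 1)) ^ 2 := Finset.sum_le_sum fun i _ =>
        pow_le_pow_left₀ dist_nonneg (hτ i).2.2.le 2
      refine h1.trans_lt ?_
      rw [Finset.sum_const, Finset.card_univ, Fintype.card_fin, nsmul_eq_mul, div_pow,
        mul_div_assoc', div_lt_iff₀ (by positivity), mul_comm]
      have : (0 : ℝ) ≤ r := Nat.cast_nonneg r
      gcongr
      nlinarith
    obtain ⟨k, hk1, hk2⟩ := ((hsum.eventually_lt_const hlt).and
      (hz.1.eventually_gt_atTop ((n : ℝ) + 1))).exists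
    refine ⟨γ * h ^ k, Γ.mul_mem hγ (Γ.pow_mem hΓ k), ?_, ?_⟩
    · rwa [h0]
    · rw [h0]
      exact lt_of_pow_lt_pow_left₀ 2 hε0.le hk1
  choose γ hγ hfar hclose using step
  have hfar' : Tendsto (fun n => dist (σ'.1 0) (γ n • x)) atTop atTop :=
    tendsto_atTop_mono (fun n => (hfar n).le)
      (tendsto_atTop_add_const_right _ _ tendsto_natCast_atTop_atTop)
  refine mem_closure_of_tendsto (tendsto_point σ' hfar' fun t => ?_) (Eventually.of_forall fun n =>
    ⟨γ n • x, ⟨⟨γ n, hγ n⟩, rfl⟩, rfl⟩)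
  rw [tendsto_iff_dist_tendsto_zero]
  refine squeeze_zero' (Eventually.of_forall fun _ => dist_nonneg) ?_
    tendsto_one_div_add_atTop_nhds_zero_nat
  have hn : ∀ᶠ n : ℕ in atTop, t ≤ (n : ℝ≥0) :=
    tendsto_natCast_atTop_atTop.eventually_ge_atTop t
  filter_upwards [hn] with n hn
  have hle : t ≤ (n : ℝ≥0) + 1 := hn.trans le_self_add
  refine ((dist_geo_ray_le σ' hle (by push_cast; exact (hfar n).le)).trans ?_).trans (hclose n).le
  exact mul_le_of_le_one_left dist_nonneg
    (div_le_one_of_le₀ (by exact_mod_cast hle) (NNReal.coe_nonneg _))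

omit [∀ i, CNSpace (X i)] in
/-- Finitely many conditions, each of which fails for at most one natural number, can be satisfied
simultaneously. -/
lemma exists_forall_not_of_subsingleton {p : Fin r → ℕ → Prop}
    (h : ∀ i, {k | p i k}.Subsingleton) : ∃ k, ∀ i, ¬ p i k := by
  have hfin : (⋃ i, {k | p i k}).Finite := Set.finite_iUnion fun i => (h i).finite
  obtain ⟨k, hk⟩ := hfin.exists_notMem
  exact ⟨k, fun i hi => hk (Set.mem_iUnion.2 ⟨i, hi⟩)⟩

/-- The Furstenberg limit set is contained in the closure of every orbit. -/
lemma furstenbergLimitSet_subset_closure [∀ i, ProperSpace (X i)]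
    (Γ : Subgroup (∀ i, X i ≃ᵢ X i)) (x : PiLp 2 X)
    {g h : ∀ i, X i ≃ᵢ X i} (hgΓ : g ∈ Γ) (hhΓ : h ∈ Γ) {σ τ : ∀ i, ℝ → X i} {l l' : Fin r → ℝ}
    (G : ∀ i, IsRankOneAxis (g i) (τ i) (l' i)) (H : ∀ i, IsRankOneAxis (h i) (σ i) (l i))
    (hind : ∀ i, IndependentIsometries (g i) (h i)) (η : FurstenbergBoundary X) :
    furstenbergLimitSet Γ x ⊆ closure {ξ | ∃ γ ∈ Γ, ξ = γ • η} := by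
  rintro _ ⟨⟨_, σ', θ, rfl, hθ, hslope⟩, hL, rfl⟩
  set ρ := coordRay σ' θ hθ hslope with hρ
  have hproj : furstenbergProj ⟨σ'.endpoint, σ', θ, rfl, hθ, hslope⟩ = fun i => (ρ i).endpoint :=
    funext fun i => furstenbergProj_endpoint σ' θ hθ hslope i
  rw [hproj]
  have hρ0 : ∀ i, (ρ i).1 0 = σ'.1 0 i := fun i => by
    change σ'.1 (0 / θ i) i = _
    rw [zero_div]
  have step : ∀ n : ℕ, ∃ γ ∈ Γ, Bordification.point (γ • x) ∈
      coneNhd σ' ((n : ℝ≥0) + 1) (1 / ((n : ℝ) + 1)) := by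
    intro n
    obtain ⟨_, hmem, ⟨_, ⟨⟨γ, hγ⟩, rfl⟩, rfl⟩⟩ := mem_closure_iff.1 hL _
      (isOpen_coneNhd σ' (R := (n : ℝ≥0) + 1) (ε := 1 / ((n : ℝ) + 1)) (by positivity)
        (by positivity)) (endpoint_mem_coneNhd _ _ (by positivity))
    exact ⟨γ, hγ, hmem⟩
  choose γ hγ hcone using step
  simp only [point_mem_coneNhd] at hcone
  have hfar : Tendsto (fun n => dist (σ'.1 0) (γ n • x)) atTop atTop :=
    tendsto_atTop_mono (fun n => by simpa using (hcone n).1.le)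
      (tendsto_atTop_add_const_right _ (1 : ℝ) tendsto_natCast_atTop_atTop)
  have hgeo : ∀ t : ℝ≥0, Tendsto (fun n => geo (σ'.1 0) (γ n • x) t) atTop (𝓝 (σ'.1 t)) := by
    intro t
    rw [tendsto_iff_dist_tendsto_zero]
    refine squeeze_zero' (Eventually.of_forall fun _ => dist_nonneg) ?_
      tendsto_one_div_add_atTop_nhds_zero_nat
    have hn : ∀ᶠ n : ℕ in atTop, t ≤ (n : ℝ≥0) :=
      tendsto_natCast_atTop_atTop.eventually_ge_atTop t
    filter_upwards [hn] with n hn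
    have hle : t ≤ (n : ℝ≥0) + 1 := hn.trans le_self_add
    refine ((dist_geo_ray_le σ' hle (hcone n).1.le).trans ?_).trans (hcone n).2.le
    exact mul_le_of_le_one_left dist_nonneg
      (div_le_one_of_le₀ (by exact_mod_cast hle) (NNReal.coe_nonneg _))
  have hcoord := tendsto_coord hθ hslope hfar hgeo
  simp only [← hρ0, smul_piLp_apply] at hcoord
  have hmove : ∀ (i : Fin r) (p : X i),
      Tendsto (fun n => dist ((ρ i).1 0) (γ n i p)) atTop atTop ∧
      ∀ t : ℝ≥0, Tendsto (fun n => geo ((ρ i).1 0) (γ n i p) t) atTop (𝓝 ((ρ i).1 t)) := by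
    intro i p
    have := fun t : ℝ≥0 => tendsto_geo_of_dist_le (hcoord i).1 (z' := fun n => γ n i p)
      (C := dist (x i) p) (fun n => ((γ n i).dist_eq _ _).le) t.coe_nonneg ((hcoord i).2 t)
    exact ⟨(this 0).1, fun t => (this t).2⟩
  -- A single ultrafilter makes the backward orbits `(γ n i)⁻¹` converge in all coordinates
  -- simultaneously.
  set u := Ultrafilter.of (atTop : Filter ℕ)
  have hu : (u : Filter ℕ) ≤ atTop := Ultrafilter.of_le _
  have hback : ∀ i, Tendsto (fun n => dist ((ρ i).1 0) ((γ n i)⁻¹ ((ρ i).1 0))) u atTop := by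
    intro i
    refine (((hmove i ((ρ i).1 0)).1).mono_left hu).congr fun n => ?_
    have e : γ n i ((γ n i)⁻¹ ((ρ i).1 0)) = (ρ i).1 0 := (γ n i).apply_symm_apply _
    rw [← (γ n i).dist_eq ((ρ i).1 0) ((γ n i)⁻¹ ((ρ i).1 0)), e, dist_comm]
  choose ζ hζ0 hζ using fun i => exists_ray_of_tendsto u _ _ (hback i)
  have hne := fun i => (hind i).endpoint_ne (G i) (H i)
  -- General position: `g ^ k` moves every `ζ i` off the positive end of the axis of `h i`, and `g ^
  -- k'` moves every `η i` off the negative end.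
  obtain ⟨k, hk⟩ := exists_forall_not_of_subsingleton fun i =>
    (G i).subsingleton_pow_smul_eq (ζ i).endpoint (hne i).1.1 (hne i).1.2
  obtain ⟨k', hk'⟩ := exists_forall_not_of_subsingleton fun i =>
    (G i).subsingleton_pow_smul_eq (η i) (hne i).2.1 (hne i).2.2
  choose η' hη' using fun i => exists_ray_endpoint (g i ^ k' • η i)
  have hpass : ∀ i, ∃ N₀ : ℕ, ∀ N ≥ N₀, ∃ C, ∀ᶠ n in u, ∀ᶠ T in atTop, ∃ a ∈ Set.Icc (0 : ℝ) 1,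
      dist ((ρ i).1 0) (seg ((γ n i * (g i ^ k)⁻¹)⁻¹ ((ρ i).1 0)) ((h i ^ N) ((η' i).1 T)) a) ≤ C := by
    intro i
    have e0 : ∀ n, (γ n i * (g i ^ k)⁻¹)⁻¹ ((ρ i).1 0) = (g i ^ k) ((γ n i)⁻¹ ((ρ i).1 0)) :=
      fun n => by rw [mul_inv_rev, inv_inv, IsometryEquiv.mul_apply]
    simp only [e0]
    have e1 : ((ζ i).map (g i ^ k)).1 0 = (g i ^ k) ((ρ i).1 0) := by rw [← hζ0]; rfl
    refine (H i).exists_dist_seg_pow_le _ (ρ := (ζ i).map (g i ^ k)) ?_ (fun t => ?_) (hk i) ?_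
    · simp only [e1, (g i ^ k).dist_eq]
      exact hback i
    · rw [e1]
      refine (((g i ^ k).continuous.tendsto _).comp (hζ i t)).congr' ?_
      filter_upwards [(hback i).eventually_ge_atTop (t : ℝ)] with n hn
      exact map_geo _ _ _ t.coe_nonneg hn
    · rw [hη']; exact hk' i
  choose N₀ hN₀ using hpass
  -- One power of `h` has to serve all coordinates.
  set N := Finset.univ.sup N₀ with hN
  choose C hC using fun i => hN₀ i N (Finset.le_sup (Finset.mem_univ i))
  set υ : ∀ i, GeodesicRay (X i) := fun i => (η' i).map (h i ^ N) with hυ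
  choose s hs0 hs using fun (n : ℕ) (i : Fin r) =>
    exists_asymptotic_ray ((υ i).map (γ n i * (g i ^ k)⁻¹)) ((ρ i).1 0)
  refine mem_closure_of_rays (F := (u : Filter ℕ)) ρ s (fun n => ?_) hs0 fun i t => ?_
  · refine ⟨γ n * (g ^ k)⁻¹ * h ^ N * g ^ k', ?_, ?_⟩
    · exact Γ.mul_mem (Γ.mul_mem (Γ.mul_mem (hγ n) (Γ.inv_mem (Γ.pow_mem hgΓ k)))
        (Γ.pow_mem hhΓ N)) (Γ.pow_mem hgΓ k')
    · funext i
      have e : (s n i).endpoint = ((υ i).map (γ n i * (g i ^ k)⁻¹)).endpoint :=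
        GeodesicRay.endpoint_eq_iff.2 (Asymptotic.symm ⟨_, hs n i⟩)
      rw [e, map_endpoint, hυ, map_endpoint, hη', smul_smul, smul_smul]
      rfl
  · refine tendsto_ray_of_dist_seg_le (γ := fun n => γ n i * (g i ^ k)⁻¹) (ρ := ρ i) (υ := υ i)
      (r := fun n => s n i) ?_ (fun t => ?_) (hC i) (fun n => hs0 n i) (fun n => ⟨_, hs n i⟩) t
    -- The extra factor only replaces the base point by another fixed point, which does not change
    -- the limit.
    · exact ((hmove i ((g i ^ k)⁻¹ ((ρ i).1 0))).1).mono_left hu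
    · exact ((hmove i ((g i ^ k)⁻¹ ((ρ i).1 0))).2 t).mono_left hu

end Limit

end HadamardProduct

/-! ### Minimality -/

open HadamardProduct
theorem theorem5p1 {r : ℕ} (hr : 1 ≤ r) {X : Fin r → Type*} [∀ i, MetricSpace (X i)]
    [∀ i, LocallyCompactSpace (X i)] (hX : ∀ i, IsHadamardSpace (X i))
    (Γ : Subgroup (∀ i, X i ≃ᵢ X i)) (hΓ : ProperlyDiscontinuousSMul Γ (PiLp 2 X))
    (hind : ∃ g ∈ Γ, ∃ h ∈ Γ, IsRegularAxial g ∧ IsRegularAxial h ∧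
      ∀ i, IndependentIsometries (g i) (h i))
    (x : PiLp 2 X) :
    IsLeast {A : Set (FurstenbergBoundary X) |
        A.Nonempty ∧ IsClosed A ∧ ∀ γ ∈ Γ, ∀ ξ ∈ A, γ • ξ ∈ A}
      (furstenbergLimitSet Γ x) := by
  have : ∀ i, CNSpace (X i) := fun i => (hX i).cnSpace
  have : ∀ i, CompleteSpace (X i) := fun i => (hX i).complete
  have : ∀ i, ProperSpace (X i) := fun i => properSpace_of_locallyCompact
  obtain ⟨g, hgΓ, h, hhΓ, hg, hh, hgh⟩ := hind
  choose τ l' G using fun i => (hg i).exists_axis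
  choose σ l H using fun i => (hh i).exists_axis
  have hsub := furstenbergLimitSet_subset_closure Γ x hgΓ hhΓ G H hgh
  -- For the orbit of the attracting point of `h` both inclusions hold, so the limit set is a single
  -- orbit closure.
  have heq := (hsub _).antisymm (closure_orbit_subset hr Γ x hhΓ H)
  refine ⟨?_, fun A ⟨⟨η, hη⟩, hcl, hinv⟩ => (hsub η).trans (closure_minimal ?_ hcl)⟩
  · rw [heq]
    refine ⟨⟨_, subset_closure ⟨1, Γ.one_mem, rfl⟩⟩, isClosed_closure, fun γ hγ ξ hξ =>
      smul_mem_closure ?_ hξ⟩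
    rintro _ ⟨γ', hγ', rfl⟩
    exact ⟨γ * γ', Γ.mul_mem hγ hγ', smul_smul _ _ _⟩
  · rintro _ ⟨γ, hγ, rfl⟩
    exact hinv γ hγ η hη
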